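/- Theorem. Let $A$ be a unital $C^*$-algebra. Let $U(A)$ be its unitary group with the norm topology and $U_A$ the connected component of $1$ in $U(A)$. Let $\mathrm{Aut}(A)$ be the group of $*$-automorphisms of $A$ with the topology of pointwise norm convergence, let $\mathrm{Ad}(u)(a)=uau^*$ for $u\in U(A)$, $a\in A$, and let $V_A=\overline{\{\mathrm{Ad}(u)\mid u\in U_A\}}\le \mathrm{Aut}(A)$. For a closed two-sided ideal $I$ of $A$ let $U_I$ be the connected component of $1$ in $U(I)=\{u\in U(A)\mid u-1\in I\}$, let $V_I=\overline{\{\mathrm{Ad}(u)\mid u\in U_I\}}\le V_A$, and let $P_I:V_A\to V_{A/I}$ be the homomorphism determined by $P_I(\varphi)\circ\pi_I=\pi_I\circ\varphi$, where $\pi_I:A\to A/I$ is the quotient map. Call $I$ perfect if $I$ is equal to the closed two-sided ideal of $A$ generated by the linear span $[I,I]$ of the commutators $xy-yx$ with $x,y\in I$. Then the set of all closed normal subgroups of $V_A$ is equal to the disjoint union \[\bigsqcup_{I\subseteq A\ \text{perfect ideal}}\{H\le V_A \mid H \text{ is closed and } V_I\le H\le\ker(P_I)\}.\] That is, a closed subgroup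 $H$ of $V_A$ is normal in $V_A$ if and only if $V_I\le H\le\ker(P_I)$ for some perfect ideal $I$, and such an $I$ is then unique. -/

import Mathlib

noncomputable section

namespace CStarNormal

variable {A : Type*} [CStarAlgebra A]

/-! ### Closed two-sided ideals -/

/-- A closed two-sided ideal of a unital C⋆-algebra (norm closed; no star condition is imposed). -/
@[ext]
structure ClosedIdeal (A : Type*) [CStarAlgebra A] where
  toIdeal : Ideal A
  isTwoSided : toIdeal.IsTwoSided
  isClosed : IsClosed (toIdeal : Set A)

instance (I : ClosedIdeal A) : I.toIdeal.IsTwoSided := I.isTwoSided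

instance (I : ClosedIdeal A) : IsClosed (I.toIdeal : Set A) := I.isClosed

/-- `Id_A(S)`: the closed two-sided ideal generated by a subset `S`. -/
def idealGeneratedBy (S : Set A) : ClosedIdeal A where
  toIdeal := sInf {J : Ideal A | J.IsTwoSided ∧ IsClosed (J : Set A) ∧ S ⊆ J}
  isTwoSided := ⟨fun {a} b ha => by
    simp only [Submodule.mem_sInf, Set.mem_ofPred_eq] at ha ⊢
    intro J hJ
    have := hJ.1
    exact Ideal.mul_mem_right b J (ha J hJ)⟩
  isClosed := by
    rw [Submodule.coe_sInf]
    exact isClosed_biInter fun J hJ => hJ.2.1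

/-- `[S, T]`: the complex linear span of the commutators `x y - y x` with `x ∈ S`, `y ∈ T`. -/
def commutatorSpan (S T : Set A) : Submodule ℂ A :=
  Submodule.span ℂ {z | ∃ x ∈ S, ∃ y ∈ T, z = x * y - y * x}

/-- A closed two-sided ideal `I` is perfect if `I = Id_A([I, I])`. -/
def ClosedIdeal.IsPerfect (I : ClosedIdeal A) : Prop :=
  I = idealGeneratedBy (commutatorSpan (I.toIdeal : Set A) (I.toIdeal : Set A) : Set A)

/-! ### The quotient C⋆-algebra `A / I` -/

theorem exists_regularizer {p : A} [PartialOrder A] [StarOrderedRing A] (hp : 0 ≤ p)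
    {δ : ℝ} (hδ : 0 < δ) :
    ∃ q y : A, IsSelfAdjoint q ∧ q = 1 - p * y ∧ ‖q‖ ≤ 1 ∧ ‖q * p * q‖ ≤ δ := by
  have hs : ∀ t ∈ spectrum ℝ p, 0 ≤ t := fun t ht => spectrum_nonneg_of_nonneg hp ht
  have hsa : IsSelfAdjoint p := .of_nonneg hp
  have hc : ContinuousOn (fun t : ℝ => (δ + t)⁻¹) (spectrum ℝ p) :=
    ContinuousOn.inv₀ (by fun_prop) fun t ht => by have := hs t ht; positivity
  have hq : ContinuousOn (fun t : ℝ => 1 - t * (δ + t)⁻¹) (spectrum ℝ p) := by fun_prop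
  refine ⟨cfc (fun t : ℝ => 1 - t * (δ + t)⁻¹) p, cfc (fun t : ℝ => (δ + t)⁻¹) p,
    cfc_predicate _ _, ?_, ?_, ?_⟩
  · rw [cfc_sub (fun _ : ℝ => (1 : ℝ)) (fun t : ℝ => t * (δ + t)⁻¹) p,
      cfc_mul (fun t : ℝ => t) (fun t : ℝ => (δ + t)⁻¹) p, cfc_id' ℝ p, cfc_const_one ℝ p]
  · refine norm_cfc_le zero_le_one fun t ht => ?_
    have h0 := hs t ht
    have : 1 - t * (δ + t)⁻¹ = δ / (δ + t) := by field_simp; ring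
    rw [this, Real.norm_of_nonneg (by positivity), div_le_one (by positivity)]
    linarith
  · nth_rewrite 2 [← cfc_id' ℝ p]
    rw [← cfc_mul (fun t : ℝ => 1 - t * (δ + t)⁻¹) (fun t : ℝ => t) p,
      ← cfc_mul (fun t : ℝ => (1 - t * (δ + t)⁻¹) * t) (fun t : ℝ => 1 - t * (δ + t)⁻¹) p]
    refine norm_cfc_le hδ.le fun t ht => ?_
    have h0 := hs t ht
    have : (1 - t * (δ + t)⁻¹) * t * (1 - t * (δ + t)⁻¹) = δ * (δ * t / (δ + t) ^ 2) := by
      field_simp; ring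
    rw [this, Real.norm_of_nonneg (by positivity)]
    refine mul_le_of_le_one_right hδ.le ?_
    rw [div_le_one (by positivity)]
    nlinarith

/-- A closed two-sided ideal of a C⋆-algebra is automatically closed under the involution. -/
theorem ClosedIdeal.star_mem (I : ClosedIdeal A) {x : A} (hx : x ∈ I.toIdeal) :
    star x ∈ I.toIdeal := by
  let _ : PartialOrder A := CStarAlgebra.spectralOrder A
  have _ : StarOrderedRing A := CStarAlgebra.spectralOrderedRing A
  have key : star x ∈ closure (I.toIdeal : Set A) := by
    rw [Metric.mem_closure_iff]
    intro ε hε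
    obtain ⟨q, y, hq, hqy, -, hn⟩ := exists_regularizer (p := x * star x)
      (mul_star_self_nonneg x) (δ := (ε / 2) ^ 2) (by positivity)
    refine ⟨star x * (x * star x * y), ?_, ?_⟩
    · refine I.toIdeal.mul_mem_left _ (I.toIdeal.mul_mem_right _ (I.toIdeal.mul_mem_right _ hx))
    · have h1 : star x - star x * (x * star x * y) = star x * q := by
        rw [hqy]; noncomm_ring
      rw [dist_eq_norm, h1]
      have h2 : ‖star x * q‖ * ‖star x * q‖ ≤ (ε / 2) ^ 2 := by
        rw [← CStarRing.norm_star_mul_self, star_mul, star_star, hq.star_eq]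
        simpa only [mul_assoc] using hn
      have := abs_le_of_sq_le_sq' (by rw [sq]; exact h2 : ‖star x * q‖ ^ 2 ≤ (ε / 2) ^ 2)
        (by positivity)
      linarith [this.2]
  rwa [I.isClosed.closure_eq] at key

/-- The quotient `A / I`, with the quotient norm. -/
abbrev ClosedIdeal.Quotient (I : ClosedIdeal A) : Type _ := A ⧸ I.toIdeal

/-- The quotient map `π_I : A → A / I`. -/
def ClosedIdeal.proj (I : ClosedIdeal A) : A →+* I.Quotient := Ideal.Quotient.mk I.toIdeal

theorem ClosedIdeal.proj_surjective (I : ClosedIdeal A) : Function.Surjective I.proj :=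
  Ideal.Quotient.mk_surjective

theorem ClosedIdeal.proj_eq_proj (I : ClosedIdeal A) {x y : A} :
    I.proj x = I.proj y ↔ x - y ∈ I.toIdeal := Ideal.Quotient.eq

theorem ClosedIdeal.norm_proj_le (I : ClosedIdeal A) (x : A) : ‖I.proj x‖ ≤ ‖x‖ :=
  Submodule.Quotient.norm_mk_le I.toIdeal x

theorem ClosedIdeal.exists_norm_lt (I : ClosedIdeal A) (x : I.Quotient) {ε : ℝ} (hε : 0 < ε) :
    ∃ a : A, I.proj a = x ∧ ‖a‖ < ‖x‖ + ε :=
  Submodule.Quotient.norm_mk_lt x hε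

/-- The C⋆-inequality for the quotient norm, on representatives. -/
theorem ClosedIdeal.norm_proj_sq_le (I : ClosedIdeal A) (a c : A)
    (h : c - star a * a ∈ I.toIdeal) : ‖I.proj a‖ ^ 2 ≤ ‖c‖ := by
  let _ : PartialOrder A := CStarAlgebra.spectralOrder A
  have _ : StarOrderedRing A := CStarAlgebra.spectralOrderedRing A
  have smul_mem : ∀ (r : ℝ) {x : A}, x ∈ I.toIdeal → r • x ∈ I.toIdeal := fun r x hx => by
    rw [Algebra.smul_def]; exact I.toIdeal.mul_mem_left _ hx
  set d : A := (1 / 2 : ℝ) • (c + star c) with hd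
  have hdsa : IsSelfAdjoint d := by
    simp only [IsSelfAdjoint, hd, star_smul, star_add, star_star, star_trivial, add_comm]
  have hdn : ‖d‖ ≤ ‖c‖ := by
    rw [hd, norm_smul]
    have := norm_add_le c (star c)
    rw [norm_star] at this
    norm_num
    linarith
  set b : A := d - star a * a with hb
  have hbI : b ∈ I.toIdeal := by
    have h2 := smul_mem (1 / 2) (I.toIdeal.add_mem h (I.star_mem h))
    convert h2 using 1
    rw [hb, hd, star_sub, star_mul, star_star]
    have : star a * a = (1 / 2 : ℝ) • (star a * a + star a * a) := by
      rw [← two_smul ℝ (star a * a), smul_smul]; norm_num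
    nth_rewrite 1 [this]
    rw [← smul_sub]
    congr 1
    abel
  have hbsa : IsSelfAdjoint b := hdsa.sub (.star_mul_self a)
  have key : ∀ ε : ℝ, 0 < ε → ‖I.proj a‖ ^ 2 ≤ ‖c‖ + 2 * ε ^ 2 := by
    intro ε hε
    set r : A := (1 / (2 * ε)) • b with hr
    have hrsa : IsSelfAdjoint r := by
      simp only [IsSelfAdjoint, hr, star_smul, star_trivial, hbsa.star_eq]
    have hrI : r ∈ I.toIdeal := smul_mem _ hbI
    have hp : 0 ≤ r * r := hrsa.mul_self_nonneg
    obtain ⟨q, y, hq, hqy, hq1, hqp⟩ := exists_regularizer hp (δ := ε ^ 2) (by positivity)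
    -- `- b ≤ ε² + r²`
    have h1 : -b ≤ algebraMap ℝ A (ε ^ 2) + r * r := by
      have hs : IsSelfAdjoint (ε • (1 : A) + r) := by
        simp only [IsSelfAdjoint, star_add, star_smul, star_one, star_trivial, hrsa.star_eq]
      have h0 := hs.mul_self_nonneg
      have hbr : b = (2 * ε) • r := by
        rw [hr, smul_smul, mul_one_div_cancel (by positivity), one_smul]
      have : (ε • (1 : A) + r) * (ε • (1 : A) + r) = algebraMap ℝ A (ε ^ 2) + r * r + b := by
        rw [hbr, Algebra.algebraMap_eq_smul_one]
        simp only [add_mul, mul_add, smul_mul_assoc, mul_smul_comm, one_mul, mul_one, smul_add,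
          two_mul, add_smul, mul_smul, pow_two]
        abel
      rw [this] at h0
      simpa [neg_le_iff_add_nonneg] using h0
    have h2 : star a * a ≤ algebraMap ℝ A (‖c‖ + ε ^ 2) + r * r := by
      have hdle : d ≤ algebraMap ℝ A ‖c‖ :=
        hdsa.le_algebraMap_norm_self.trans (algebraMap_mono A hdn)
      have : star a * a = d + -b := by rw [hb]; abel
      rw [this, map_add, add_assoc]
      exact add_le_add hdle h1
    have h3 : star (a * q) * (a * q) ≤ q * algebraMap ℝ A (‖c‖ + ε ^ 2) * q + q * (r * r) * q := by
      have := star_left_conjugate_le_conjugate h2 q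
      rw [hq.star_eq] at this
      rw [star_mul, hq.star_eq]
      simpa only [mul_assoc, mul_add, add_mul] using this
    have h4 : ‖a * q‖ ^ 2 ≤ ‖c‖ + 2 * ε ^ 2 := by
      have h5 := CStarAlgebra.norm_le_norm_of_nonneg_of_le (star_mul_self_nonneg (a * q)) h3
      rw [CStarRing.norm_star_mul_self, ← sq] at h5
      refine h5.trans ((norm_add_le _ _).trans ?_)
      have h6 : ‖q * algebraMap ℝ A (‖c‖ + ε ^ 2) * q‖ ≤ ‖c‖ + ε ^ 2 := by
        rw [Algebra.algebraMap_eq_smul_one, mul_smul_comm, mul_one, smul_mul_assoc, norm_smul,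
          Real.norm_of_nonneg (by positivity)]
        refine mul_le_of_le_one_right (by positivity) ((norm_mul_le _ _).trans ?_)
        exact mul_le_one₀ hq1 (norm_nonneg _) hq1
      linarith
    have h7 : I.proj a = I.proj (a * q) := by
      rw [I.proj_eq_proj, hqy]
      have : a - a * (1 - r * r * y) = a * (r * r * y) := by noncomm_ring
      rw [this]
      exact I.toIdeal.mul_mem_left _
        (I.toIdeal.mul_mem_right _ (I.toIdeal.mul_mem_right _ hrI))
    rw [h7]
    exact (pow_le_pow_left₀ (norm_nonneg _) (I.norm_proj_le _) 2).trans h4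
  refine le_of_forall_pos_le_add fun η hη => ?_
  have := key (Real.sqrt (η / 2)) (by positivity)
  rw [Real.sq_sqrt (by positivity)] at this
  linarith

instance (I : ClosedIdeal A) : NormedRing I.Quotient where
  __ := (inferInstance : Ring (A ⧸ I.toIdeal))
  __ := (inferInstance : NormedAddCommGroup (A ⧸ I.toIdeal))
  norm_mul_le x y := by
    refine le_of_forall_pos_le_add fun ε hε => ?_
    have ht : Filter.Tendsto (fun δ : ℝ => (‖x‖ + δ) * (‖y‖ + δ)) (nhdsWithin 0 (Set.Ioi 0))
        (nhds (‖x‖ * ‖y‖)) := by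
      have : Continuous fun δ : ℝ => (‖x‖ + δ) * (‖y‖ + δ) := by fun_prop
      have := this.tendsto 0
      simp only [add_zero] at this
      exact this.mono_left nhdsWithin_le_nhds
    have hev := (ht.eventually (gt_mem_nhds (show ‖x‖ * ‖y‖ < ‖x‖ * ‖y‖ + ε by linarith))).and
      self_mem_nhdsWithin
    obtain ⟨δ, h1, hδ⟩ := hev.exists
    obtain ⟨a, rfl, ha⟩ := I.exists_norm_lt x hδ
    obtain ⟨b, rfl, hb⟩ := I.exists_norm_lt y hδ
    calc ‖I.proj a * I.proj b‖ = ‖I.proj (a * b)‖ := by rw [map_mul]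
      _ ≤ ‖a * b‖ := I.norm_proj_le _
      _ ≤ ‖a‖ * ‖b‖ := norm_mul_le _ _
      _ ≤ _ := mul_le_mul ha.le hb.le (norm_nonneg _) ((norm_nonneg _).trans ha.le)
      _ ≤ _ := h1.le

instance (I : ClosedIdeal A) : StarRing I.Quotient where
  star := Quotient.lift (fun a => I.proj (star a)) fun a b hab => by
    rw [I.proj_eq_proj, ← star_sub]
    exact I.star_mem ((Submodule.quotientRel_def _).1 hab)
  star_involutive x := by
    obtain ⟨a, rfl⟩ := I.proj_surjective x
    exact congrArg I.proj (star_star a)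
  star_mul x y := by
    obtain ⟨a, rfl⟩ := I.proj_surjective x
    obtain ⟨b, rfl⟩ := I.proj_surjective y
    exact congrArg I.proj (star_mul a b)
  star_add x y := by
    obtain ⟨a, rfl⟩ := I.proj_surjective x
    obtain ⟨b, rfl⟩ := I.proj_surjective y
    exact congrArg I.proj (star_add a b)

theorem ClosedIdeal.proj_star (I : ClosedIdeal A) (a : A) : I.proj (star a) = star (I.proj a) := rfl

theorem ClosedIdeal.proj_smul (I : ClosedIdeal A) (z : ℂ) (a : A) :
    I.proj (z • a) = z • I.proj a := rfl

/-- `A / I` is a unital C⋆-algebra. -/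
instance (I : ClosedIdeal A) : CStarAlgebra I.Quotient where
  __ := (inferInstance : Algebra ℂ (A ⧸ I.toIdeal))
  __ := (inferInstance : CompleteSpace (A ⧸ I.toIdeal))
  norm_smul_le z x := norm_smul_le z x
  norm_mul_self_le x := by
    obtain ⟨a, rfl⟩ := I.proj_surjective x
    refine le_of_forall_pos_le_add fun ε hε => ?_
    obtain ⟨c, hc, hcn⟩ := I.exists_norm_lt (star (I.proj a) * I.proj a) hε
    rw [← I.proj_star, ← map_mul, I.proj_eq_proj] at hc
    rw [← sq]
    exact (I.norm_proj_sq_le a c hc).trans hcn.le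
  star_smul z x := by
    obtain ⟨a, rfl⟩ := I.proj_surjective x
    exact congrArg I.proj (star_smul z a)

theorem ClosedIdeal.continuous_proj (I : ClosedIdeal A) : Continuous I.proj :=
  continuous_iff_continuousAt.2 fun x => by
    rw [ContinuousAt, tendsto_iff_norm_sub_tendsto_zero]
    refine squeeze_zero (fun _ => norm_nonneg _)
      (fun y => by rw [← map_sub]; exact I.norm_proj_le _)
      (tendsto_iff_norm_sub_tendsto_zero.1 (Filter.tendsto_id (x := nhds x)))

/-- The quotient map as a map of ⋆-monoids, used to push unitaries forward. -/
def ClosedIdeal.projStar (I : ClosedIdeal A) : A →⋆* I.Quotient where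
  toFun := I.proj
  map_one' := map_one _
  map_mul' := map_mul _
  map_star' := I.proj_star

/-! ### The automorphism group with the topology of pointwise norm convergence -/

/-- The topology of pointwise norm convergence on `Aut(A)`. -/
instance instTopologicalSpaceAut : TopologicalSpace (A ≃⋆ₐ[ℂ] A) :=
  TopologicalSpace.induced (fun (φ : A ≃⋆ₐ[ℂ] A) (x : A) => φ x) Pi.topologicalSpace

theorem continuous_aut_apply (x : A) : Continuous fun φ : A ≃⋆ₐ[ℂ] A => φ x :=
  (continuous_apply x).comp continuous_induced_dom

theorem continuous_aut_iff {X : Type*} [TopologicalSpace X] {f : X → (A ≃⋆ₐ[ℂ] A)} :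
    Continuous f ↔ ∀ x : A, Continuous fun t => f t x := by
  rw [continuous_induced_rng, continuous_pi_iff]
  rfl

instance instIsTopologicalGroupAut : IsTopologicalGroup (A ≃⋆ₐ[ℂ] A) where
  continuous_mul := by
    rw [continuous_aut_iff]
    intro x
    rw [continuous_iff_continuousAt]
    rintro ⟨φ, ψ⟩
    rw [ContinuousAt, tendsto_iff_dist_tendsto_zero]
    have h1 : Filter.Tendsto (fun t : (A ≃⋆ₐ[ℂ] A) × (A ≃⋆ₐ[ℂ] A) =>
        dist (t.2 x) (ψ x) + dist (t.1 (ψ x)) (φ (ψ x))) (nhds (φ, ψ)) (nhds 0) := by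
      have hc : Continuous (fun t : (A ≃⋆ₐ[ℂ] A) × (A ≃⋆ₐ[ℂ] A) =>
          dist (t.2 x) (ψ x) + dist (t.1 (ψ x)) (φ (ψ x))) :=
        (((continuous_aut_apply x).comp continuous_snd).dist continuous_const).add
          (((continuous_aut_apply (ψ x)).comp continuous_fst).dist continuous_const)
      simpa using hc.tendsto (φ, ψ)
    refine squeeze_zero (fun _ => dist_nonneg) (fun t => ?_) h1
    calc dist (t.1 (t.2 x)) (φ (ψ x)) ≤ dist (t.1 (t.2 x)) (t.1 (ψ x)) + dist (t.1 (ψ x)) (φ (ψ x)) :=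
          dist_triangle _ _ _
      _ = _ := by rw [(StarAlgEquiv.isometry t.1).dist_eq]
  continuous_inv := by
    rw [continuous_aut_iff]
    intro x
    rw [continuous_iff_continuousAt]
    intro φ
    rw [ContinuousAt, tendsto_iff_dist_tendsto_zero]
    have h1 : Filter.Tendsto (fun t : A ≃⋆ₐ[ℂ] A => dist x (t (φ⁻¹ x))) (nhds φ) (nhds 0) := by
      have hc : Continuous (fun t : A ≃⋆ₐ[ℂ] A => dist x (t (φ⁻¹ x))) :=
        continuous_const.dist (continuous_aut_apply _)
      have h2 : φ (φ⁻¹ x) = x := φ.apply_symm_apply x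
      simpa [h2] using hc.tendsto φ
    refine squeeze_zero (fun _ => dist_nonneg) (fun t => le_of_eq ?_) h1
    have h2 : t (t⁻¹ x) = x := t.apply_symm_apply x
    rw [← (StarAlgEquiv.isometry t).dist_eq, h2]

/-! ### The groups `U_A`, `U_I`, `V_A`, `V_I` -/

/-- `Ad : U(A) → Aut(A)`, `Ad(u)(a) = u a u⋆`. -/
def Ad : unitary A →* (A ≃⋆ₐ[ℂ] A) := Unitary.conjStarAlgAut ℂ A

theorem Ad_apply (u : unitary A) (a : A) : Ad u a = (u : A) * a * star (u : A) := rfl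

/-- `U_A`: the connected component of the unit of the unitary group (norm topology). -/
def unitaryComponent (A : Type*) [CStarAlgebra A] : Subgroup (unitary A) :=
  Subgroup.connectedComponentOfOne (unitary A)

/-- `U(I)`: the group of unitaries `u` of `A` with `u - 1 ∈ I`. -/
def ClosedIdeal.unitaryGroup (I : ClosedIdeal A) : Subgroup (unitary A) where
  carrier := {u | (u : A) - 1 ∈ I.toIdeal}
  one_mem' := by simp
  mul_mem' {u v} hu hv := by
    have : ((u * v : unitary A) : A) - 1 = u * ((v : A) - 1) + ((u : A) - 1) := by
      push_cast; noncomm_ring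
    simp only [Set.mem_ofPred_eq] at hu hv ⊢
    rw [this]
    exact I.toIdeal.add_mem (I.toIdeal.mul_mem_left _ hv) hu
  inv_mem' {u} hu := by
    have : ((u⁻¹ : unitary A) : A) - 1 = star ((u : A) - 1) := by
      rw [star_sub, star_one]; rfl
    simp only [Set.mem_ofPred_eq] at hu ⊢
    rw [this]
    exact I.star_mem hu

/-- `U_I`: the connected component of the unit of `U(I)`. -/
def ClosedIdeal.unitaryComponent (I : ClosedIdeal A) : Subgroup (unitary A) :=
  (Subgroup.connectedComponentOfOne I.unitaryGroup).map I.unitaryGroup.subtype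

/-- `V_A`: the closure of `Ad(U_A)` in `Aut(A)`. -/
def V (A : Type*) [CStarAlgebra A] : Subgroup (A ≃⋆ₐ[ℂ] A) :=
  ((unitaryComponent A).map Ad).topologicalClosure

/-- The closure of `Ad(U_I)` in `Aut(A)`. -/
def ClosedIdeal.VAut (I : ClosedIdeal A) : Subgroup (A ≃⋆ₐ[ℂ] A) :=
  (I.unitaryComponent.map Ad).topologicalClosure

theorem ClosedIdeal.unitaryComponent_le (I : ClosedIdeal A) :
    I.unitaryComponent ≤ CStarNormal.unitaryComponent A := by
  rintro _ ⟨u, hu, rfl⟩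
  exact continuous_subtype_val.image_connectedComponent_subset (1 : I.unitaryGroup) ⟨u, hu, rfl⟩

theorem ClosedIdeal.VAut_le (I : ClosedIdeal A) : I.VAut ≤ CStarNormal.V A :=
  closure_mono (Subgroup.map_mono I.unitaryComponent_le)

/-- `V_I`: the closure of `Ad(U_I)`, as a subgroup of `V_A` (it is contained in `V_A`). -/
def ClosedIdeal.V (I : ClosedIdeal A) : Subgroup (CStarNormal.V A) :=
  I.VAut.subgroupOf (CStarNormal.V A)

/-! ### The induced map `P_I : V_A → V_{A/I}` -/

theorem ClosedIdeal.apply_mem (I : ClosedIdeal A) {φ : A ≃⋆ₐ[ℂ] A} (hφ : φ ∈ CStarNormal.V A)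
    {x : A} (hx : x ∈ I.toIdeal) : φ x ∈ I.toIdeal := by
  have hcl : IsClosed {ψ : A ≃⋆ₐ[ℂ] A | ψ x ∈ I.toIdeal} :=
    I.isClosed.preimage (continuous_aut_apply x)
  refine closure_minimal ?_ hcl hφ
  rintro _ ⟨u, -, rfl⟩
  exact I.toIdeal.mul_mem_right _ (I.toIdeal.mul_mem_left _ hx)

/-- The map `π_I(x) ↦ π_I(φ x)` on `A / I`. -/
def ClosedIdeal.inducedFun (I : ClosedIdeal A) (φ : CStarNormal.V A) : I.Quotient → I.Quotient :=
  Quotient.lift (fun a => I.proj (φ.1 a)) fun a b hab => by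
    rw [I.proj_eq_proj, ← map_sub]
    exact I.apply_mem φ.2 ((Submodule.quotientRel_def _).1 hab)

theorem ClosedIdeal.inducedFun_proj (I : ClosedIdeal A) (φ : CStarNormal.V A) (a : A) :
    I.inducedFun φ (I.proj a) = I.proj (φ.1 a) := rfl

/-- The automorphism of `A / I` induced by `φ ∈ V_A`. -/
def ClosedIdeal.inducedAut (I : ClosedIdeal A) (φ : CStarNormal.V A) :
    I.Quotient ≃⋆ₐ[ℂ] I.Quotient where
  toFun := I.inducedFun φ
  invFun := I.inducedFun φ⁻¹
  left_inv x := by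
    obtain ⟨a, rfl⟩ := I.proj_surjective x
    exact congrArg I.proj (φ.1.symm_apply_apply a)
  right_inv x := by
    obtain ⟨a, rfl⟩ := I.proj_surjective x
    exact congrArg I.proj (φ.1.apply_symm_apply a)
  map_mul' x y := by
    obtain ⟨a, rfl⟩ := I.proj_surjective x
    obtain ⟨b, rfl⟩ := I.proj_surjective y
    exact congrArg I.proj (map_mul φ.1 a b)
  map_add' x y := by
    obtain ⟨a, rfl⟩ := I.proj_surjective x
    obtain ⟨b, rfl⟩ := I.proj_surjective y
    exact congrArg I.proj (map_add φ.1 a b)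
  map_star' x := by
    obtain ⟨a, rfl⟩ := I.proj_surjective x
    exact congrArg I.proj (map_star φ.1 a)
  map_smul' z x := by
    obtain ⟨a, rfl⟩ := I.proj_surjective x
    exact congrArg I.proj (map_smul φ.1 z a)

theorem ClosedIdeal.inducedAut_proj (I : ClosedIdeal A) (φ : CStarNormal.V A) (a : A) :
    I.inducedAut φ (I.proj a) = I.proj (φ.1 a) := rfl

theorem ClosedIdeal.continuous_inducedAut (I : ClosedIdeal A) : Continuous I.inducedAut := by
  rw [continuous_aut_iff]
  intro x
  obtain ⟨a, rfl⟩ := I.proj_surjective x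
  exact I.continuous_proj.comp ((continuous_aut_apply a).comp continuous_subtype_val)

theorem ClosedIdeal.map_mem_unitaryComponent (I : ClosedIdeal A) {u : unitary A}
    (hu : u ∈ CStarNormal.unitaryComponent A) :
    Unitary.map I.projStar u ∈ CStarNormal.unitaryComponent I.Quotient := by
  have hc : Continuous (Unitary.map I.projStar) :=
    (I.continuous_proj.comp continuous_subtype_val).subtype_mk _
  have h := hc.image_connectedComponent_subset (1 : unitary A) ⟨u, hu, rfl⟩
  rwa [map_one] at h

theorem ClosedIdeal.inducedAut_mem (I : ClosedIdeal A) (φ : CStarNormal.V A) :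
    I.inducedAut φ ∈ CStarNormal.V I.Quotient := by
  set S : Set (CStarNormal.V A) := {ψ | ∃ u ∈ CStarNormal.unitaryComponent A, Ad u = ψ.1} with hS
  have hφ : φ ∈ closure S := by
    rw [closure_subtype]
    have h2 : (φ : A ≃⋆ₐ[ℂ] A) ∈ closure
        (((CStarNormal.unitaryComponent A).map Ad : Subgroup _) : Set (A ≃⋆ₐ[ℂ] A)) := φ.2
    refine closure_mono ?_ h2
    rintro _ ⟨u, hu, rfl⟩
    exact ⟨⟨Ad u, subset_closure ⟨u, hu, rfl⟩⟩, ⟨u, hu, rfl⟩, rfl⟩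
  have hsub : I.inducedAut '' S ⊆
      (((CStarNormal.unitaryComponent I.Quotient).map Ad : Subgroup _) :
        Set (I.Quotient ≃⋆ₐ[ℂ] I.Quotient)) := by
    rintro _ ⟨ψ, ⟨u, hu, hψ⟩, rfl⟩
    refine ⟨Unitary.map I.projStar u, I.map_mem_unitaryComponent hu, ?_⟩
    refine StarAlgEquiv.ext fun x => ?_
    obtain ⟨a, rfl⟩ := I.proj_surjective x
    rw [I.inducedAut_proj, ← hψ, Ad_apply (A := A), map_mul, map_mul, I.proj_star]
    rfl
  exact closure_mono hsub (image_closure_subset_closure_image I.continuous_inducedAut ⟨φ, hφ, rfl⟩)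

/-- The homomorphism `P_I : V_A → V_{A/I}`, determined by `P_I(φ) ∘ π_I = π_I ∘ φ`. -/
def ClosedIdeal.P (I : ClosedIdeal A) : CStarNormal.V A →* CStarNormal.V I.Quotient where
  toFun φ := ⟨I.inducedAut φ, I.inducedAut_mem φ⟩
  map_one' := by
    refine Subtype.ext (StarAlgEquiv.ext fun x => ?_)
    obtain ⟨a, rfl⟩ := I.proj_surjective x
    rfl
  map_mul' φ ψ := by
    refine Subtype.ext (StarAlgEquiv.ext fun x => ?_)
    obtain ⟨a, rfl⟩ := I.proj_surjective x
    rfl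

/-- The set of closed subgroups `H` of `V_A` with `V_I ≤ H ≤ ker P_I`. -/
def ClosedIdeal.closedSubgroupsBetween (I : ClosedIdeal A) : Set (Subgroup (CStarNormal.V A)) :=
  {H | IsClosed (H : Set (CStarNormal.V A)) ∧ I.V ≤ H ∧ H ≤ I.P.ker}

end CStarNormal

end

/-!
Let `H` be a closed normal subgroup of `V_A`. The ideal attached to `H` is the closed ideal `J`
generated by all displacements `φ(x) - x` with `φ ∈ H`, so that `H ≤ ker P_J` by construction. The
work is to show that `J` is perfect and that `V_J ≤ H`.

*Tangent elements.* An element `x` is tangent to `H` (`IsTangent`) if to first order `H` contains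
`1 + s [x, ·]` for small `s > 0`, pointwise on `A`. Tangent elements form a closed real
subspace that is stable under brackets with skew-adjoint elements, and if `i h` is tangent for a
selfadjoint `h`, then `Ad(exp(i h)) ∈ H`
(`Ad_expUnitary_mem_of_isTangent`), since the distance of the flow from `H` grows at rate zero. The
group commutators of `Ad(exp(i s h))` with `φ ∈ H` show that `i h - φ(i h)` is tangent
(`isTangent_sub_apply`). Therefore the complexification `L` of the skew-adjoint tangent elements
(`tangentSpace`) is a closed `⋆`-stable Lie ideal of `A` containing all `φ(x) - x`.

*From Lie ideals to ideals.* By Herstein's argument the closed ideal `K` generated by `[L, L]`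
satisfies `[K, A] ⊆ L` (`lie_mem_of_mem_idealGeneratedBy`). Modulo `K` the Lie ideal `L` commutes, so
it is central (`lie_mem_of_commutator_mem`), and an element of `V_A` that moves each element by a
central one is trivial (`apply_eq_self_of_sub_central`). Consequently `φ(x) - x ∈ K`, that is
`J ⊆ K`, and `[J, A] ⊆ L`. The same argument with `J` in place of `L` shows that `J` is perfect.

*From `[J, A]` to `J`.* It remains to see that all skew-adjoint elements of `J` are tangent. Tangency
of `x` depends only on the derivation `[x, ·]` and is closed under pointwise limits of derivations, so
by Hahn–Banach it is enough that a functional `g(x) = ∑ fᵢ([x, bᵢ])` vanishing on `[J, A]` vanishes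
on `J` (`tracial_commutatorFunctional_eq_zero`). Such a `g` is tracial on `J`; its Jordan
decomposition consists of two orthogonal positive tracial functionals, which in a suitable
representation `π` are separated by a projection `p` in the centre of `π(A)''`
(`exists_separating_projection`). The double commutant theorem approximates `p` by elements `k ∈ J`.
There `g(k)` tends to `0`, because `p` commutes with all `π(bᵢ)`, and also to the norm of the positive
part of `g`. So both parts of `g` vanish.

*The converse and uniqueness.* If `φ ∈ ker P_I` and `u ∈ U_A`, then the group commutator of `Ad(u)` and
`φ` is `Ad(u φ(u)⁻¹)` with `u φ(u)⁻¹ ∈ U_I`; so `[V_A, ker P_I] ⊆ V_I`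
(`ClosedIdeal.commutator_mem_VAut`), and each group between `V_I` and `ker P_I` is normal. If
`V_I ≤ ker P_J`, differentiating one-parameter groups gives `[I, A] ⊆ J`, hence `I ⊆ J` for perfect `I`
(`ClosedIdeal.le_of_VAut_le`).
-/

noncomputable section

namespace CStarNormal

open scoped ComplexOrder InnerProductSpace ComplexConjugate Topology
open Filter

-- `⁅x, y⁆` denotes the commutator `x * y - y * x`
attribute [local instance] LieRing.ofAssociativeRing

/-! ### Jordan decomposition of hermitian functionals -/

section Jordan

variable {A : Type*} [CStarAlgebra A] [PartialOrder A] [StarOrderedRing A]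

/-- A real linear functional on `A` that is nonnegative on every element with nonnegative real part
is the real part of a positive functional. -/
theorem exists_positive_extension (f : A →ₗ[ℝ] ℝ) (hf : ∀ a, 0 ≤ a + star a → 0 ≤ f a) :
    ∃ ω : A →ₚ[ℂ] ℂ, ∀ a, ω a = (f a : ℂ) - Complex.I * f (Complex.I • a) := by
  refine ⟨PositiveLinearMap.mk₀ (Module.Dual.extendRCLike (𝕜 := ℂ) f) fun x hx => ?_, fun a => ?_⟩
  · have hs : star x = x := (IsSelfAdjoint.of_nonneg hx).star_eq
    have h1 : 0 ≤ f x := hf x (by rw [hs]; exact add_nonneg hx hx)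
    have h2 : 0 ≤ f (Complex.I • x) := hf _ (by simp [star_smul, hs])
    have h3 : 0 ≤ f (-(Complex.I • x)) := hf _ (by simp [star_smul, hs])
    rw [map_neg] at h3
    have h4 : f (Complex.I • x) = 0 := by linarith
    have : Module.Dual.extendRCLike (𝕜 := ℂ) f x = (f x : ℂ) := by
      rw [Module.Dual.extendRCLike_apply]
      simp [h4]
    rw [this]
    exact_mod_cast h1
  · exact Module.Dual.extendRCLike_apply (𝕜 := ℂ) f a

omit [PartialOrder A] [StarOrderedRing A] in
theorem re_apply_eq_of_hermitian {g : StrongDual ℂ A} (hg : ∀ x, g (star x) = conj (g x)) (y : A) :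
    (g (y + star y)).re = 2 * (g y).re := by
  rw [map_add, hg]
  simp
  ring

omit [PartialOrder A] [StarOrderedRing A] in
theorem add_star_add_smul_one (y : A) (t : ℝ) :
    (y + t • (1 : A)) + star (y + t • (1 : A)) = algebraMap ℝ A (2 * t) + (y + star y) := by
  rw [star_add, star_smul, star_one, star_trivial t, Algebra.algebraMap_eq_smul_one, mul_smul,
    two_smul ℝ (t • (1 : A))]
  abel

theorem nonneg_add_star_add_smul_one {y : A} {t : ℝ} (h : ‖y‖ ≤ t) :
    0 ≤ (y + t • (1 : A)) + star (y + t • (1 : A)) := by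
  have hsa : IsSelfAdjoint (y + star y) := .add_star_self y
  have h1 := hsa.neg_algebraMap_norm_le_self
  have h2 : ‖y + star y‖ ≤ 2 * t := by
    refine (norm_add_le _ _).trans ?_
    rw [norm_star]
    linarith
  have h3 : algebraMap ℝ A ‖y + star y‖ ≤ algebraMap ℝ A (2 * t) := algebraMap_mono A h2
  rw [add_star_add_smul_one, ← neg_le_iff_add_nonneg']
  exact (neg_le_neg h3).trans h1

theorem norm_add_star_le [Nontrivial A] {y : A} {t : ℝ}
    (h1 : 0 ≤ (y + t • (1 : A)) + star (y + t • (1 : A)))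
    (h2 : 0 ≤ (-y + t • (1 : A)) + star (-y + t • (1 : A))) :
    0 ≤ t ∧ ‖y + star y‖ ≤ 2 * t := by
  have hsa : IsSelfAdjoint (y + star y) := .add_star_self y
  have e2 : algebraMap ℝ A (2 * t) + (-y + star (-y)) = algebraMap ℝ A (2 * t) - (y + star y) := by
    rw [star_neg]
    abel
  rw [add_star_add_smul_one] at h1 h2
  rw [e2, sub_nonneg, le_algebraMap_iff_spectrum_le (R := ℝ) (ha := hsa)] at h2
  rw [← neg_le_iff_add_nonneg', ← map_neg,
    algebraMap_le_iff_le_spectrum (R := ℝ) (ha := hsa)] at h1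
  rcases CStarAlgebra.norm_or_neg_norm_mem_spectrum (a := y + star y) hsa with h | h
  · have := h1 _ h
    have := h2 _ h
    have := norm_nonneg (y + star y)
    constructor <;> linarith
  · have := h1 _ h
    have := h2 _ h
    have := norm_nonneg (y + star y)
    constructor <;> linarith

/-- **Jordan decomposition**: a bounded hermitian functional is a difference of two positive
functionals whose norms add up to its norm. The pair is obtained from M. Riesz' extension theorem on
`A × A`, where the antidiagonal carries `g` and `(1, 1)` is sent to `‖g‖`. -/
theorem exists_jordan_decomposition (g : StrongDual ℂ A) (hg : ∀ x, g (star x) = conj (g x)) :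
    ∃ ω₁ ω₂ : A →ₚ[ℂ] ℂ, (∀ x, g x = ω₁ x - ω₂ x) ∧ (ω₁ 1).re + (ω₂ 1).re = ‖g‖ := by
  rcases subsingleton_or_nontrivial A with hA | hA
  · have hg0 : g = 0 := by
      ext x
      rw [Subsingleton.elim x 0]
      simp
    exact ⟨0, 0, fun x => by simp [hg0], by simp [hg0]⟩
  let Λ : A × ℝ →ₗ[ℝ] A × A :=
    { toFun := fun p => (p.1 + p.2 • (1 : A), -p.1 + p.2 • (1 : A))
      map_add' := fun p q => by
        ext <;> simp only [Prod.fst_add, Prod.snd_add, add_smul] <;> abel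
      map_smul' := fun r p => by
        ext <;> simp [smul_smul] }
  have hΛ : Function.Injective Λ := by
    rw [← LinearMap.ker_eq_bot, LinearMap.ker_eq_bot']
    rintro ⟨y, t⟩ h
    have h1 : y + t • (1 : A) = 0 := congrArg Prod.fst h
    have h2 : -y + t • (1 : A) = 0 := congrArg Prod.snd h
    have h3 : (2 * t) • (1 : A) = 0 := by
      rw [mul_smul, two_smul]
      calc t • (1 : A) + t • (1 : A) = (y + t • (1 : A)) + (-y + t • (1 : A)) := by abel
        _ = 0 := by rw [h1, h2, add_zero]
    have h4 : t = 0 := by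
      rcases smul_eq_zero.1 h3 with h | h
      · linarith
      · exact absurd h one_ne_zero
    subst h4
    simpa using h1
  let F : A × ℝ →ₗ[ℝ] ℝ :=
    { toFun := fun p => (g p.1).re + p.2 * ‖g‖
      map_add' := fun p q => by
        simp only [Prod.fst_add, Prod.snd_add, map_add, Complex.add_re]
        ring
      map_smul' := fun r p => by
        have : g (r • p.1) = (r : ℂ) * g p.1 := by
          rw [← Complex.coe_smul, map_smul, smul_eq_mul]
        simp only [Prod.smul_fst, Prod.smul_snd, this, RingHom.id_apply, smul_eq_mul,
          Complex.re_ofReal_mul]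
        ring }
  let C : PointedCone ℝ (A × A) :=
    { carrier := {p | 0 ≤ p.1 + star p.1 ∧ 0 ≤ p.2 + star p.2}
      add_mem' := fun {p q} hp hq => by
        constructor
        · have := add_nonneg hp.1 hq.1
          simp only [Prod.fst_add, star_add]
          convert this using 1
          abel
        · have := add_nonneg hp.2 hq.2
          simp only [Prod.snd_add, star_add]
          convert this using 1
          abel
      zero_mem' := by simp
      smul_mem' := fun c p hp => by
        have e : ∀ y : A, c • y + star (c • y) = (c : ℝ) • (y + star y) := fun y => by
          rw [smul_add]
          congr 1
          change star ((c : ℝ) • y) = _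
          rw [star_smul, star_trivial]
        exact ⟨by
          have := smul_nonneg c.2 hp.1
          rw [← e] at this
          exact this, by
          have := smul_nonneg c.2 hp.2
          rw [← e] at this
          exact this⟩ }
  obtain ⟨Φ, hΦ, hpos⟩ := riesz_extension C
    ⟨LinearMap.range Λ, F ∘ₗ (LinearEquiv.ofInjective Λ hΛ).symm.toLinearMap⟩ (by
      rintro ⟨_, ⟨y, t⟩, rfl⟩ hx
      have e : (LinearEquiv.ofInjective Λ hΛ).symm ⟨Λ (y, t), ⟨(y, t), rfl⟩⟩ = (y, t) := by
        rw [LinearEquiv.symm_apply_eq]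
        rfl
      obtain ⟨ht, hn⟩ := norm_add_star_le hx.1 hx.2
      change 0 ≤ F ((LinearEquiv.ofInjective Λ hΛ).symm ⟨Λ (y, t), ⟨(y, t), rfl⟩⟩)
      rw [e]
      change 0 ≤ (g y).re + t * ‖g‖
      have h1 := re_apply_eq_of_hermitian hg y
      have h2 : -(‖g‖ * (2 * t)) ≤ (g (y + star y)).re := by
        refine (abs_le.1 ((Complex.abs_re_le_norm _).trans ?_)).1
        exact (g.le_opNorm _).trans (by gcongr)
      linarith) (by
      rintro ⟨y, z⟩
      refine ⟨⟨Λ (0, ‖y‖ + ‖z‖), ⟨_, rfl⟩⟩, ?_, ?_⟩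
      · have := nonneg_add_star_add_smul_one (y := y) (t := ‖y‖ + ‖z‖) (by simp)
        simpa [Λ, add_comm] using this
      · have := nonneg_add_star_add_smul_one (y := z) (t := ‖y‖ + ‖z‖) (by simp)
        simpa [Λ, add_comm] using this)
  have key : ∀ y t, Φ (Λ (y, t)) = (g y).re + t * ‖g‖ := fun y t => by
    have := hΦ ⟨Λ (y, t), ⟨(y, t), rfl⟩⟩
    refine this.trans ?_
    have e : (LinearEquiv.ofInjective Λ hΛ).symm ⟨Λ (y, t), ⟨(y, t), rfl⟩⟩ = (y, t) := by
      rw [LinearEquiv.symm_apply_eq]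
      rfl
    change F ((LinearEquiv.ofInjective Λ hΛ).symm ⟨Λ (y, t), ⟨(y, t), rfl⟩⟩) = _
    rw [e]
    rfl
  obtain ⟨ω₁, h1⟩ := exists_positive_extension (Φ ∘ₗ LinearMap.inl ℝ A A)
    (fun a ha => hpos (a, 0) ⟨ha, by simp⟩)
  obtain ⟨ω₂, h2⟩ := exists_positive_extension (Φ ∘ₗ LinearMap.inr ℝ A A)
    (fun a ha => hpos (0, a) ⟨by simp, ha⟩)
  have hsub : ∀ y : A, Φ (y, 0) - Φ (0, y) = (g y).re := fun y => by
    have := key y 0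
    rw [← map_sub]
    simpa [Λ] using this
  refine ⟨ω₁, ω₂, fun x => ?_, ?_⟩
  · rw [h1, h2]
    simp only [LinearMap.comp_apply, LinearMap.inl_apply, LinearMap.inr_apply]
    have e1 := hsub x
    have e2 := hsub (Complex.I • x)
    rw [map_smul] at e2
    simp at e2
    apply Complex.ext <;> simp <;> linarith
  · rw [h1, h2]
    simp only [LinearMap.comp_apply, LinearMap.inl_apply, LinearMap.inr_apply]
    have := key 0 1
    have e : Λ (0, 1) = ((1 : A), 0) + (0, 1) := by simp [Λ]
    rw [e, map_add] at this
    simpa using this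

end Jordan

/-! ### Functional calculus in closed ideals -/

section Ideals

variable {A : Type*} [CStarAlgebra A]

theorem ClosedIdeal.smul_mem (I : ClosedIdeal A) (z : ℂ) {x : A} (hx : x ∈ I.toIdeal) :
    z • x ∈ I.toIdeal := by
  rw [Algebra.smul_def]
  exact I.toIdeal.mul_mem_left _ hx

theorem ClosedIdeal.proj_eq_zero (I : ClosedIdeal A) {x : A} : I.proj x = 0 ↔ x ∈ I.toIdeal :=
  Ideal.Quotient.eq_zero_iff_mem

/-- The quotient map `π_I` as a unital `⋆`-homomorphism. -/
def ClosedIdeal.projStarAlgHom (I : ClosedIdeal A) : A →⋆ₐ[ℂ] I.Quotient where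
  toFun := I.proj
  map_one' := map_one _
  map_mul' := map_mul _
  map_zero' := map_zero _
  map_add' := map_add _
  commutes' z := by
    rw [Algebra.algebraMap_eq_smul_one, I.proj_smul, map_one, Algebra.algebraMap_eq_smul_one]
  map_star' := I.proj_star

theorem ClosedIdeal.continuous_projStarAlgHom (I : ClosedIdeal A) : Continuous I.projStarAlgHom :=
  I.continuous_proj

theorem ClosedIdeal.posPart_mem (I : ClosedIdeal A) {x : A} (hx : x ∈ I.toIdeal)
    (hsa : IsSelfAdjoint x) : x⁺ ∈ I.toIdeal := by
  rw [← I.proj_eq_zero, CFC.posPart_def]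
  have h := StarAlgHomClass.map_cfc (R := ℝ) (S := ℂ) I.projStarAlgHom (·⁺ : ℝ → ℝ) x
    (hφ := I.continuous_projStarAlgHom) (hφa := hsa.map _)
  have h0 : I.projStarAlgHom x = 0 := I.proj_eq_zero.2 hx
  rw [cfcₙ_eq_cfc]
  refine h.trans ?_
  rw [h0, cfc_apply_zero]
  simp

theorem ClosedIdeal.negPart_mem (I : ClosedIdeal A) {x : A} (hx : x ∈ I.toIdeal)
    (hsa : IsSelfAdjoint x) : x⁻ ∈ I.toIdeal := by
  have := I.posPart_mem (I.toIdeal.neg_mem hx) hsa.neg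
  rwa [CFC.posPart_neg] at this

/-- The logarithm of a unitary in `1 + I` of distance less than `2` from `1` lies in `I`. -/
theorem ClosedIdeal.argSelfAdjoint_mem (I : ClosedIdeal A) {u : unitary A}
    (hu : (u : A) - 1 ∈ I.toIdeal) (hn : ‖(u - 1 : A)‖ < 2) :
    (Unitary.argSelfAdjoint u : A) ∈ I.toIdeal := by
  have hc : ContinuousOn (fun z : ℂ => (Complex.arg z : ℂ)) (spectrum ℂ (u : A)) :=
    Complex.continuous_ofReal.comp_continuousOn (Complex.continuousOn_arg.mono
      ((Unitary.spectrum_subset_slitPlane_iff_norm_lt_two u.2).mpr hn))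
  have h1 : I.projStarAlgHom (u : A) = 1 := by
    have := (I.proj_eq_proj (x := (u : A)) (y := 1)).2 hu
    rwa [map_one] at this
  have hq : IsStarNormal (I.projStarAlgHom (u : A)) := by
    rw [h1]
    infer_instance
  rw [← I.proj_eq_zero, Unitary.argSelfAdjoint_coe]
  refine (StarAlgHomClass.map_cfc (R := ℂ) (S := ℂ) I.projStarAlgHom
    (fun z : ℂ => (Complex.arg z : ℂ)) (u : A) (hf := hc)
    (hφ := I.continuous_projStarAlgHom) (hφa := hq)).trans ?_
  rw [h1, cfc_apply_one]
  simp

theorem subset_idealGeneratedBy (S : Set A) : S ⊆ (idealGeneratedBy S).toIdeal := by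
  intro x hx
  simp only [idealGeneratedBy, SetLike.mem_coe, Submodule.mem_sInf, Set.mem_ofPred_eq]
  exact fun J hJ => hJ.2.2 hx

theorem idealGeneratedBy_le {S : Set A} {J : ClosedIdeal A} (h : S ⊆ J.toIdeal) :
    (idealGeneratedBy S).toIdeal ≤ J.toIdeal :=
  sInf_le ⟨J.isTwoSided, J.isClosed, h⟩

end Ideals

/-! ### Tracial functionals on ideals -/

section Tracial

variable {A : Type*} [CStarAlgebra A] [PartialOrder A] [StarOrderedRing A]

/-- The Cauchy–Schwarz inequality for a positive functional. -/
theorem norm_apply_star_mul_le (ω : A →ₚ[ℂ] ℂ) (a b : A) :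
    ‖ω (star a * b)‖ ≤ √(ω (star a * a)).re * √(ω (star b * b)).re := by
  have := norm_inner_le_norm (𝕜 := ℂ) (ω.toPreGNS a) (ω.toPreGNS b)
  rwa [ω.preGNS_inner_def, ω.preGNS_norm_def, ω.preGNS_norm_def] at this

omit [StarOrderedRing A] in
theorem re_apply_nonneg (ω : A →ₚ[ℂ] ℂ) {a : A} (ha : 0 ≤ a) : 0 ≤ (ω a).re :=
  (Complex.nonneg_iff.1 (ω.map_nonneg ha)).1

theorem re_apply_mono (ω : A →ₚ[ℂ] ℂ) {a b : A} (h : a ≤ b) : (ω a).re ≤ (ω b).re := by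
  have := re_apply_nonneg ω (sub_nonneg.2 h)
  rw [map_sub, Complex.sub_re] at this
  linarith

theorem re_apply_star_mul_self_le (ω : A →ₚ[ℂ] ℂ) (a : A) :
    (ω (star a * a)).re ≤ ‖a‖ ^ 2 * (ω 1).re := by
  have h := re_apply_mono ω (CStarAlgebra.star_mul_le_algebraMap_norm_sq (a := a))
  have e : ω (algebraMap ℝ A (‖a‖ ^ 2)) = ((‖a‖ ^ 2 : ℝ) : ℂ) * ω 1 := by
    rw [Algebra.algebraMap_eq_smul_one, ← Complex.coe_smul, map_smul, smul_eq_mul]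
  rwa [e, Complex.re_ofReal_mul] at h

theorem mul_self_le_self {e : A} (h0 : 0 ≤ e) (h1 : e ≤ 1) : e * e ≤ e := by
  have hsa : IsSelfAdjoint e := .of_nonneg h0
  have h := CStarAlgebra.pow_antitone h0 h1 (show 1 ≤ 2 by norm_num)
  simpa [pow_two] using h

/-- `ω₁` and `ω₂` are almost orthogonal, as witnessed by `e`; then `ω₁` is almost determined by
`ω₁ - ω₂`. -/
theorem norm_apply_sub_le (ω₁ ω₂ : A →ₚ[ℂ] ℂ) {e : A} (h0 : 0 ≤ e) (h1 : e ≤ 1) {ε : ℝ}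
    (he₁ : (ω₁ (1 - e)).re ≤ ε) (he₂ : (ω₂ e).re ≤ ε) (y : A) :
    ‖ω₁ y - (ω₁ (e * y) - ω₂ (e * y))‖ ≤ √ε * (‖y‖ * √(ω₁ 1).re + ‖y‖ * √(ω₂ 1).re) := by
  have hsa : IsSelfAdjoint e := .of_nonneg h0
  have hsa' : IsSelfAdjoint (1 - e) := (IsSelfAdjoint.one A).sub hsa
  have hb : ∀ (ω : A →ₚ[ℂ] ℂ) (f : A), 0 ≤ f → f ≤ 1 → (ω f).re ≤ ε →
      ‖ω (f * y)‖ ≤ √ε * (‖y‖ * √(ω 1).re) := fun ω f hf0 hf1 hf => by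
    have hfs : star f = f := (IsSelfAdjoint.of_nonneg hf0).star_eq
    have h := norm_apply_star_mul_le ω f y
    rw [hfs] at h
    refine h.trans (mul_le_mul ?_ ?_ (Real.sqrt_nonneg _) (Real.sqrt_nonneg _))
    · exact Real.sqrt_le_sqrt ((re_apply_mono ω (mul_self_le_self hf0 hf1)).trans hf)
    · rw [← Real.sqrt_sq (norm_nonneg y), ← Real.sqrt_mul (sq_nonneg _)]
      exact Real.sqrt_le_sqrt (re_apply_star_mul_self_le ω y)
  have e1 : ω₁ y - (ω₁ (e * y) - ω₂ (e * y)) = ω₁ ((1 - e) * y) + ω₂ (e * y) := by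
    rw [sub_mul, one_mul, map_sub]
    ring
  rw [e1, mul_add]
  exact (norm_add_le _ _).trans (add_le_add (hb ω₁ _ (sub_nonneg.2 h1) (by simpa using h0) he₁)
    (hb ω₂ _ h0 h1 he₂))

theorem posPart_le_one {x : A} (hn : ‖x‖ ≤ 1) : x⁺ ≤ 1 := by
  have h := (CStarAlgebra.norm_posPart_le x).trans hn
  exact (CStarAlgebra.norm_le_one_iff_of_nonneg _ (CFC.posPart_nonneg x)).1 h

/-- If the selfadjoint contraction `x` almost attains the norm of `ω₁ - ω₂`, then its positive part
witnesses that `ω₁` and `ω₂` are almost orthogonal. -/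
theorem apply_posPart_of_almost_norming (ω₁ ω₂ : A →ₚ[ℂ] ℂ) {x : A} (hsa : IsSelfAdjoint x)
    (hn : ‖x‖ ≤ 1) {ε : ℝ} (h : (ω₁ 1).re + (ω₂ 1).re - (ω₁ x - ω₂ x).re ≤ ε) :
    (ω₁ (1 - x⁺)).re ≤ ε ∧ (ω₂ x⁺).re ≤ ε := by
  have hle : x ≤ 1 := (CFC.le_posPart).trans (posPart_le_one hn)
  have hge : -x ≤ 1 := (CFC.le_posPart (ha := hsa.neg)).trans (posPart_le_one (by rwa [norm_neg]))
  have hneg : x⁻ ≤ 1 := by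
    have := posPart_le_one (x := -x) (by rwa [norm_neg])
    rwa [CFC.posPart_neg] at this
  have hdec : x⁺ - x⁻ = x := CFC.posPart_sub_negPart x hsa
  have p1 := re_apply_nonneg ω₁ (sub_nonneg.2 hle)
  have p2 := re_apply_nonneg ω₂ (neg_le_iff_add_nonneg.1 hge)
  have q1 := re_apply_mono ω₁ (sub_le_sub_left (CFC.le_posPart (a := x)) 1)
  have q2 : (ω₂ x⁺).re ≤ (ω₂ (1 + x)).re := by
    refine re_apply_mono ω₂ ?_
    nth_rewrite 2 [← hdec]
    have := add_le_add_left (sub_nonneg.2 hneg) x⁺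
    convert this using 1 <;> abel
  simp only [map_add, map_sub, Complex.add_re, Complex.sub_re] at *
  constructor <;> linarith

/-- The functional `x ↦ ω (u x u⋆)`. -/
def conjFunctional (ω : A →ₚ[ℂ] ℂ) (u : A) : A →ₚ[ℂ] ℂ :=
  PositiveLinearMap.mk₀
    { toFun := fun x => ω (u * x * star u)
      map_add' := fun x y => by rw [mul_add, add_mul, map_add]
      map_smul' := fun z x => by rw [mul_smul_comm, smul_mul_assoc, map_smul, RingHom.id_apply] }
    fun _ hx => ω.map_nonneg (star_right_conjugate_nonneg hx u)

theorem conjFunctional_apply (ω : A →ₚ[ℂ] ℂ) (u x : A) :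
    conjFunctional ω u x = ω (u * x * star u) := rfl

omit [PartialOrder A] [StarOrderedRing A] in
/-- Unitarily invariant functionals are tracial, because the unitaries span `A`. -/
theorem tracial_of_unitary_invariant (ω : A →ₗ[ℂ] ℂ)
    (h : ∀ u : unitary A, ∀ y, ω ((u : A) * y * star (u : A)) = ω y) (a b : A) :
    ω (a * b) = ω (b * a) := by
  have ha : a ∈ Submodule.span ℂ (unitary A : Set A) := by
    rw [CStarAlgebra.span_unitary]
    trivial
  induction ha using Submodule.span_induction with
  | mem u hu =>
    have := h ⟨u, hu⟩ (b * u)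
    rw [← this]
    have e : u * (b * u) * star u = u * b * (u * star u) := by noncomm_ring
    change ω (u * b) = ω (u * (b * u) * star u)
    rw [e, Unitary.mul_star_self_of_mem hu, mul_one]
  | zero => simp
  | add x y _ _ hx hy => rw [add_mul, mul_add, map_add, map_add, hx, hy]
  | smul z x _ hx => rw [smul_mul_assoc, mul_smul_comm, map_smul, map_smul, hx]

/-- The adjoint `x ↦ conj (f x⋆)` of a functional. -/
def starDual {A : Type*} [CStarAlgebra A] (f : StrongDual ℂ A) : StrongDual ℂ A :=
  LinearMap.mkContinuous
    { toFun := fun x => conj (f (star x))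
      map_add' := fun x y => by rw [star_add, map_add, map_add]
      map_smul' := fun z x => by
        rw [star_smul, map_smul, smul_eq_mul, map_mul, RingHom.id_apply, smul_eq_mul]
        simp } ‖f‖ fun x => by
      have := f.le_opNorm (star x)
      rw [norm_star] at this
      change ‖conj (f (star x))‖ ≤ _
      rwa [RCLike.norm_conj]

omit [PartialOrder A] [StarOrderedRing A] in
theorem starDual_apply (f : StrongDual ℂ A) (x : A) : starDual f x = conj (f (star x)) := rfl

omit [PartialOrder A] [StarOrderedRing A] in
theorem norm_starDual_le (f : StrongDual ℂ A) : ‖starDual f‖ ≤ ‖f‖ :=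
  LinearMap.mkContinuous_norm_le _ (norm_nonneg f) _

/-- An element that is bounded by `√ε * C` for all `ε > 0` vanishes. -/
theorem eq_zero_of_norm_le_sqrt_mul {F : Type*} [NormedAddCommGroup F] {z : F} (C : ℝ)
    (h : ∀ ε : ℝ, 0 < ε → ‖z‖ ≤ √ε * C) : z = 0 := by
  have ht : Tendsto (fun ε : ℝ => √ε * C) (𝓝[>] 0) (𝓝 0) := by
    have hc : Continuous fun ε : ℝ => √ε * C := by fun_prop
    have := hc.tendsto 0
    simp only [Real.sqrt_zero, zero_mul] at this
    exact this.mono_left nhdsWithin_le_nhds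
  exact norm_le_zero_iff.1 (ge_of_tendsto ht (eventually_nhdsWithin_of_forall fun ε hε => h ε hε))

omit [PartialOrder A] [StarOrderedRing A] in
/-- The restriction of a hermitian functional to a closed ideal has a hermitian extension to `A` of
the same norm; this norm is almost attained at selfadjoint contractions of the ideal. -/
theorem exists_hermitian_extension (J : ClosedIdeal A) (g : StrongDual ℂ A)
    (hg : ∀ x, g (star x) = conj (g x)) :
    ∃ g' : StrongDual ℂ A, (∀ x, g' (star x) = conj (g' x)) ∧ (∀ x ∈ J.toIdeal, g' x = g x) ∧
      ∀ ε : ℝ, 0 < ε → ∃ x ∈ J.toIdeal, IsSelfAdjoint x ∧ ‖x‖ ≤ 1 ∧ ‖g'‖ - (g x).re ≤ ε := by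
  let p : Submodule ℂ A := J.toIdeal.restrictScalars ℂ
  let f : StrongDual ℂ p := g.comp p.subtypeL
  obtain ⟨k, hk, hkn⟩ := exists_extension_norm_eq p f
  let g' : StrongDual ℂ A := (2⁻¹ : ℂ) • (k + starDual k)
  have hg'n : ‖g'‖ ≤ ‖f‖ := by
    have h1 := norm_add_le k (starDual k)
    have h2 := norm_starDual_le k
    rw [norm_smul, ← hkn]
    norm_num
    linarith
  have hap : ∀ x, g' x = (2⁻¹ : ℂ) * (k x + conj (k (star x))) := fun x => rfl
  refine ⟨g', fun x => ?_, fun x hx => ?_, fun ε hε => ?_⟩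
  · have h2 : conj (2 : ℂ) = 2 := map_ofNat _ 2
    rw [hap, hap, star_star, map_mul, map_add, map_inv₀, Complex.conj_conj, h2]
    ring
  · have h1 : k x = g x := hk ⟨x, hx⟩
    have h2 : k (star x) = g (star x) := hk ⟨star x, J.star_mem hx⟩
    rw [hap, h1, h2, hg, Complex.conj_conj]
    ring
  · obtain ⟨⟨x, hx⟩, hx1, hx2⟩ := f.exists_lt_apply_of_lt_opNorm (show ‖f‖ - ε < ‖f‖ by linarith)
    have hx2' : ‖f‖ - ε < ‖g x‖ := hx2
    have hx1' : ‖x‖ < 1 := hx1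
    obtain ⟨c, hc, hcx⟩ : ∃ c : ℂ, ‖c‖ ≤ 1 ∧ c * g x = ‖g x‖ := by
      by_cases h0 : g x = 0
      · exact ⟨0, by simp, by simp [h0]⟩
      · have hne : (‖g x‖ : ℂ) ≠ 0 := by simpa using h0
        refine ⟨conj (g x) / ‖g x‖, ?_, ?_⟩
        · rw [norm_div, RCLike.norm_conj, Complex.norm_real, norm_norm,
            div_self (by simpa using h0)]
        · rw [div_mul_eq_mul_div, mul_comm, Complex.mul_conj, Complex.normSq_eq_norm_sq, div_eq_iff hne]
          push_cast
          ring
    set y : A := c • x with hy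
    have hyJ : y ∈ J.toIdeal := J.smul_mem c hx
    have hyn : ‖y‖ ≤ 1 := by
      rw [hy, norm_smul]
      exact mul_le_one₀ hc (norm_nonneg _) hx1'.le
    refine ⟨(2⁻¹ : ℂ) • (y + star y), J.smul_mem _ (J.toIdeal.add_mem hyJ (J.star_mem hyJ)),
      ?_, ?_, ?_⟩
    · rw [IsSelfAdjoint, star_smul, star_add, star_star, add_comm]
      simp
    · rw [norm_smul]
      have := norm_add_le y (star y)
      rw [norm_star] at this
      norm_num
      linarith
    · have e1 : g y = ‖g x‖ := by rw [hy, map_smul, smul_eq_mul, hcx]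
      have e2 : g ((2⁻¹ : ℂ) • (y + star y)) = ‖g x‖ := by
        rw [map_smul, map_add, hg, e1, Complex.conj_ofReal, smul_eq_mul]
        ring
      rw [e2, Complex.ofReal_re]
      linarith

/-- A hermitian functional on `A` that is tracial on the ideal `J` agrees on `J` with a difference
of positive tracial functionals on `A` that are asymptotically orthogonal, as witnessed by positive
contractions of `J`. Traciality comes from the uniqueness of the Jordan decomposition. -/
theorem exists_tracial_jordan_decomposition (J : ClosedIdeal A) (g : StrongDual ℂ A)
    (hg : ∀ x, g (star x) = conj (g x))
    (hJ : ∀ x ∈ J.toIdeal, ∀ a, g (x * a) = g (a * x)) :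
    ∃ ω₁ ω₂ : A →ₚ[ℂ] ℂ, (∀ x ∈ J.toIdeal, g x = ω₁ x - ω₂ x) ∧
      (∀ a b, ω₁ (a * b) = ω₁ (b * a)) ∧ (∀ a b, ω₂ (a * b) = ω₂ (b * a)) ∧
      (∀ ε : ℝ, 0 < ε → ∃ e ∈ J.toIdeal, 0 ≤ e ∧ e ≤ 1 ∧ (ω₁ (1 - e)).re ≤ ε ∧ (ω₂ e).re ≤ ε) ∧
      (∀ ε : ℝ, 0 < ε → ∃ e ∈ J.toIdeal, 0 ≤ e ∧ e ≤ 1 ∧ (ω₂ (1 - e)).re ≤ ε ∧ (ω₁ e).re ≤ ε) := by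
  obtain ⟨g', hg', hgJ, hnorming⟩ := exists_hermitian_extension J g hg
  obtain ⟨ω₁, ω₂, hω, hn⟩ := exists_jordan_decomposition g' hg'
  have hωJ : ∀ x ∈ J.toIdeal, g x = ω₁ x - ω₂ x := fun x hx => by rw [← hgJ x hx, hω]
  -- Conjugation by a unitary gives another decomposition of `g` on `J`, and one and the same
  -- element of `J` recovers both from `g`.
  have hinv : ∀ (σ₁ σ₂ : A →ₚ[ℂ] ℂ), (∀ x ∈ J.toIdeal, g x = σ₁ x - σ₂ x) →
      (σ₁ 1).re = (ω₁ 1).re → (σ₂ 1).re = (ω₂ 1).re → (∀ y, σ₁ y = ω₁ y) ∧ ∀ y, σ₂ y = ω₂ y := by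
    intro σ₁ σ₂ hσ e1 e2
    have hb : ∀ y, ∀ ε : ℝ, 0 < ε →
        ‖σ₁ y - ω₁ y‖ ≤ √ε * (2 * (‖y‖ * √(ω₁ 1).re + ‖y‖ * √(ω₂ 1).re)) ∧
        ‖σ₂ y - ω₂ y‖ ≤ √ε * (2 * (‖y‖ * √(ω₂ 1).re + ‖y‖ * √(ω₁ 1).re)) := by
      intro y ε hε
      obtain ⟨x, hxJ, hxs, hxn, hx⟩ := hnorming ε hε
      have hp := J.posPart_mem hxJ hxs
      have hm := J.negPart_mem hxJ hxs
      have b1 : (ω₁ 1).re + (ω₂ 1).re - (ω₁ x - ω₂ x).re ≤ ε := by rw [hn, ← hωJ x hxJ]; exact hx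
      have b2 : (σ₁ 1).re + (σ₂ 1).re - (σ₁ x - σ₂ x).re ≤ ε := by
        rw [e1, e2, hn, ← hσ x hxJ]; exact hx
      have b1' : (ω₂ 1).re + (ω₁ 1).re - (ω₂ (-x) - ω₁ (-x)).re ≤ ε := by
        simp only [Complex.sub_re, map_neg, Complex.neg_re] at b1 ⊢
        linarith
      have b2' : (σ₂ 1).re + (σ₁ 1).re - (σ₂ (-x) - σ₁ (-x)).re ≤ ε := by
        simp only [Complex.sub_re, map_neg, Complex.neg_re] at b2 ⊢
        linarith
      have c1 := apply_posPart_of_almost_norming ω₁ ω₂ hxs hxn b1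
      have c2 := apply_posPart_of_almost_norming σ₁ σ₂ hxs hxn b2
      have c1' := apply_posPart_of_almost_norming ω₂ ω₁ hxs.neg (by rwa [norm_neg]) b1'
      have c2' := apply_posPart_of_almost_norming σ₂ σ₁ hxs.neg (by rwa [norm_neg]) b2'
      have p1 := posPart_le_one hxn
      have p2 := posPart_le_one (x := -x) (by rwa [norm_neg])
      have d1 := norm_apply_sub_le ω₁ ω₂ (CFC.posPart_nonneg x) p1 c1.1 c1.2 y
      have d2 := norm_apply_sub_le σ₁ σ₂ (CFC.posPart_nonneg x) p1 c2.1 c2.2 y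
      have d1' := norm_apply_sub_le ω₂ ω₁ (CFC.posPart_nonneg (-x)) p2 c1'.1 c1'.2 y
      have d2' := norm_apply_sub_le σ₂ σ₁ (CFC.posPart_nonneg (-x)) p2 c2'.1 c2'.2 y
      rw [e1, e2] at d2 d2'
      have hxy := J.toIdeal.mul_mem_right y hp
      have hxy' : (-x)⁺ * y ∈ J.toIdeal := by
        rw [CFC.posPart_neg]
        exact J.toIdeal.mul_mem_right y hm
      rw [← hωJ _ hxy] at d1
      rw [← hσ _ hxy] at d2
      rw [← neg_sub (ω₁ _), ← hωJ _ hxy'] at d1'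
      rw [← neg_sub (σ₁ _), ← hσ _ hxy'] at d2'
      constructor
      · calc ‖σ₁ y - ω₁ y‖ = ‖(σ₁ y - g (x⁺ * y)) - (ω₁ y - g (x⁺ * y))‖ := by congr 1; ring
          _ ≤ _ := norm_sub_le _ _
          _ ≤ _ := by linarith
      · calc ‖σ₂ y - ω₂ y‖ = ‖(σ₂ y - -g ((-x)⁺ * y)) - (ω₂ y - -g ((-x)⁺ * y))‖ := by
              congr 1; ring
          _ ≤ _ := norm_sub_le _ _
          _ ≤ _ := by linarith
    exact ⟨fun y => sub_eq_zero.1 (eq_zero_of_norm_le_sqrt_mul _ fun ε hε => (hb y ε hε).1),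
      fun y => sub_eq_zero.1 (eq_zero_of_norm_le_sqrt_mul _ fun ε hε => (hb y ε hε).2)⟩
  have hconj : ∀ u : unitary A, (∀ y, conjFunctional ω₁ u y = ω₁ y) ∧
      ∀ y, conjFunctional ω₂ u y = ω₂ y := fun u => by
    refine hinv _ _ (fun x hx => ?_) ?_ ?_
    · rw [conjFunctional_apply, conjFunctional_apply,
        ← hωJ _ (J.toIdeal.mul_mem_right _ (J.toIdeal.mul_mem_left _ hx)), mul_assoc,
        ← hJ _ (J.toIdeal.mul_mem_right _ hx), mul_assoc, Unitary.coe_star_mul_self, mul_one]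
    · rw [conjFunctional_apply, mul_one, Unitary.mul_star_self_of_mem u.2]
    · rw [conjFunctional_apply, mul_one, Unitary.mul_star_self_of_mem u.2]
  refine ⟨ω₁, ω₂, hωJ, tracial_of_unitary_invariant ω₁.toLinearMap fun u y => (hconj u).1 y,
    tracial_of_unitary_invariant ω₂.toLinearMap fun u y => (hconj u).2 y, fun ε hε => ?_,
    fun ε hε => ?_⟩
  · obtain ⟨x, hxJ, hxs, hxn, hx⟩ := hnorming ε hε
    have b1 : (ω₁ 1).re + (ω₂ 1).re - (ω₁ x - ω₂ x).re ≤ ε := by rw [hn, ← hωJ x hxJ]; exact hx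
    exact ⟨x⁺, J.posPart_mem hxJ hxs, CFC.posPart_nonneg x, posPart_le_one hxn,
      apply_posPart_of_almost_norming ω₁ ω₂ hxs hxn b1⟩
  · obtain ⟨x, hxJ, hxs, hxn, hx⟩ := hnorming ε hε
    have b1 : (ω₁ 1).re + (ω₂ 1).re - (ω₁ x - ω₂ x).re ≤ ε := by rw [hn, ← hωJ x hxJ]; exact hx
    have b1' : (ω₂ 1).re + (ω₁ 1).re - (ω₂ (-x) - ω₁ (-x)).re ≤ ε := by
      simp only [Complex.sub_re, map_neg, Complex.neg_re] at b1 ⊢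
      linarith
    refine ⟨(-x)⁺, ?_, CFC.posPart_nonneg _, posPart_le_one (by rwa [norm_neg]),
      apply_posPart_of_almost_norming ω₂ ω₁ hxs.neg (by rwa [norm_neg]) b1'⟩
    exact J.posPart_mem (J.toIdeal.neg_mem hxJ) hxs.neg

end Tracial

/-! ### Representations and the double commutant -/

section Representations

variable {A : Type*} [CStarAlgebra A]

section DirectSum

variable {ι : Type*} [Fintype ι] {E : ι → Type*} [∀ i, NormedAddCommGroup (E i)]
  [∀ i, InnerProductSpace ℂ (E i)]

/-- The diagonal operator on a finite Hilbert sum with the given entries. -/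
def diagOp (T : ∀ i, E i →L[ℂ] E i) : PiLp 2 E →L[ℂ] PiLp 2 E :=
  ((PiLp.continuousLinearEquiv 2 ℂ E).symm : (∀ i, E i) →L[ℂ] PiLp 2 E) ∘L
    ContinuousLinearMap.piMap T ∘L (PiLp.continuousLinearEquiv 2 ℂ E : PiLp 2 E →L[ℂ] ∀ i, E i)

omit [Fintype ι] in
theorem diagOp_apply (T : ∀ i, E i →L[ℂ] E i) (x : PiLp 2 E) (i : ι) :
    diagOp T x i = T i (x i) := rfl

/-- The finite direct sum of representations. -/
def diagRep [∀ i, CompleteSpace (E i)] (π : ∀ i, A →⋆ₐ[ℂ] (E i →L[ℂ] E i)) :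
    A →⋆ₐ[ℂ] (PiLp 2 E →L[ℂ] PiLp 2 E) where
  toFun a := diagOp fun i => π i a
  map_one' := by
    ext x i
    simp [diagOp_apply]
  map_mul' a b := by
    ext x i
    simp [diagOp_apply]
  map_zero' := by
    ext x i
    simp [diagOp_apply]
  map_add' a b := by
    ext x i
    simp [diagOp_apply]
  commutes' z := by
    ext x i
    simp [diagOp_apply, Algebra.algebraMap_eq_smul_one]
  map_star' a := by
    rw [ContinuousLinearMap.star_eq_adjoint, ContinuousLinearMap.eq_adjoint_iff]
    intro x y
    simp only [PiLp.inner_apply, diagOp_apply, map_star, ContinuousLinearMap.star_eq_adjoint,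
      ContinuousLinearMap.adjoint_inner_left]

theorem diagRep_apply [∀ i, CompleteSpace (E i)] (π : ∀ i, A →⋆ₐ[ℂ] (E i →L[ℂ] E i)) (a : A)
    (x : PiLp 2 E) (i : ι) : diagRep π a x i = π i a (x i) := rfl

end DirectSum

variable {E : Type*} [NormedAddCommGroup E] [InnerProductSpace ℂ E] [CompleteSpace E]

theorem inner_rep_left (π : A →⋆ₐ[ℂ] (E →L[ℂ] E)) (a : A) (x y : E) :
    ⟪π a x, y⟫_ℂ = ⟪x, π (star a) y⟫_ℂ := by
  rw [map_star, ContinuousLinearMap.star_eq_adjoint, ContinuousLinearMap.adjoint_inner_right]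

theorem inner_rep_right (π : A →⋆ₐ[ℂ] (E →L[ℂ] E)) (a : A) (x y : E) :
    ⟪x, π a y⟫_ℂ = ⟪π (star a) x, y⟫_ℂ := by
  rw [inner_rep_left, star_star]

/-- The orthogonal projection onto a subspace that is invariant under `T` and `T†` commutes with
`T`. -/
theorem starProjection_commute (W : Submodule ℂ E) [W.HasOrthogonalProjection] (T : E →L[ℂ] E)
    (h1 : ∀ x ∈ W, T x ∈ W) (h2 : ∀ x ∈ W, ContinuousLinearMap.adjoint T x ∈ W) :
    W.starProjection * T = T * W.starProjection := by
  ext x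
  change W.starProjection (T x) = T (W.starProjection x)
  refine W.eq_starProjection_of_mem_orthogonal (h1 _ (W.starProjection_apply_mem x)) ?_
  rw [← map_sub, Submodule.mem_orthogonal']
  intro w hw
  rw [← ContinuousLinearMap.adjoint_inner_right]
  exact W.starProjection_inner_eq_zero _ _ (h2 w hw)

/-- The commutant of a representation is closed under adjoints. -/
theorem adjoint_commutes (π : A →⋆ₐ[ℂ] (E →L[ℂ] E)) {T : E →L[ℂ] E}
    (hT : ∀ a, T * π a = π a * T) (a : A) : star T * π a = π a * star T := by
  have := congrArg star (hT (star a))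
  rw [star_mul, star_mul, ← map_star, star_star] at this
  exact this.symm

/-- One vector version of `exists_mem_ideal_approx`. -/
theorem exists_mem_ideal_approx_vector (J : ClosedIdeal A) (π : A →⋆ₐ[ℂ] (E →L[ℂ] E))
    (p : E →L[ℂ] E) (hp : p * p = p) (hpA : ∀ a, p * π a = π a * p)
    (hpc : ∀ T : E →L[ℂ] E, (∀ a, T * π a = π a * T) → p * T = T * p)
    (hpJ : ∀ y, (∀ x ∈ J.toIdeal, ∀ v, ⟪y, π x v⟫_ℂ = 0) → p y = 0)
    (v : E) {ε : ℝ} (hε : 0 < ε) : ∃ k ∈ J.toIdeal, ‖π k v - p v‖ < ε := by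
  let ev : A →ₗ[ℂ] E :=
    { toFun := fun a => π a v
      map_add' := fun a b => by rw [map_add]; rfl
      map_smul' := fun z a => by rw [map_smul]; rfl }
  let W₀ : Submodule ℂ E := (J.toIdeal.restrictScalars ℂ).map ev
  let W : Submodule ℂ E := W₀.topologicalClosure
  have hWcl : IsClosed (W : Set E) := W₀.isClosed_topologicalClosure
  have : CompleteSpace W := hWcl.completeSpace_coe
  have hinv : ∀ a, ∀ x ∈ W, π a x ∈ W := fun a x hx => by
    refine map_mem_closure (π a).continuous hx ?_
    rintro _ ⟨k, hk, rfl⟩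
    exact ⟨a * k, J.toIdeal.mul_mem_left a hk, by simp [ev]⟩
  have hq : ∀ a, W.starProjection * π a = π a * W.starProjection := fun a =>
    starProjection_commute W _ (hinv a) (by
      rw [← ContinuousLinearMap.star_eq_adjoint, ← map_star]
      exact hinv (star a))
  have hpq := hpc _ hq
  set y : E := p v - W.starProjection (p v) with hy
  -- `y` is killed by `J` since `J v ⊆ W`, so it vanishes
  have hy' : y = p (v - W.starProjection v) := by
    rw [map_sub]
    exact congrArg (p v - ·) (DFunLike.congr_fun hpq v).symm
  have hpy : p y = y := by
    rw [hy']
    exact DFunLike.congr_fun hp _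
  have hy0 : p y = 0 := hpJ y fun x hx w => by
    have hxv : π (star x) v ∈ W := subset_closure ⟨star x, J.star_mem hx, rfl⟩
    have h1 : π (star x) y = 0 := by
      rw [hy']
      have e1 : π (star x) (p (v - W.starProjection v)) = p (π (star x) (v - W.starProjection v)) :=
        (DFunLike.congr_fun (hpA (star x)) _).symm
      have e2 : π (star x) (W.starProjection v) = W.starProjection (π (star x) v) :=
        (DFunLike.congr_fun (hq (star x)) v).symm
      rw [e1, map_sub, e2, W.starProjection_eq_self_iff.2 hxv, sub_self, map_zero]
    rw [inner_rep_right, h1, inner_zero_left]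
  have hmem : p v ∈ W := by
    rw [hpy, hy, sub_eq_zero] at hy0
    rw [hy0]
    exact W.starProjection_apply_mem _
  obtain ⟨_, ⟨k, hk, rfl⟩, hd⟩ := Metric.mem_closure_iff.1 hmem ε hε
  rw [dist_comm, dist_eq_norm] at hd
  exact ⟨k, hk, hd⟩

/-- A **double commutant theorem** for a closed ideal `J`: a projection in the centre of `π(A)''`
whose range lies in the closed span of `π(J) E` is approximated by elements of `π(J)` on finitely
many vectors. -/
theorem exists_mem_ideal_approx (J : ClosedIdeal A) (π : A →⋆ₐ[ℂ] (E →L[ℂ] E))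
    (p : E →L[ℂ] E) (hp : p * p = p) (hpA : ∀ a, p * π a = π a * p)
    (hpc : ∀ T : E →L[ℂ] E, (∀ a, T * π a = π a * T) → p * T = T * p)
    (hpJ : ∀ y, (∀ x ∈ J.toIdeal, ∀ v, ⟪y, π x v⟫_ℂ = 0) → p y = 0)
    {ι : Type*} [Fintype ι] (v : ι → E) {ε : ℝ} (hε : 0 < ε) :
    ∃ k ∈ J.toIdeal, ∀ i, ‖π k (v i) - p (v i)‖ < ε := by
  classical
  have h1 : diagOp (fun _ : ι => p) * diagOp (fun _ : ι => p) = diagOp fun _ : ι => p := by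
    ext x i
    exact DFunLike.congr_fun hp (x i)
  have h2 : ∀ a, diagOp (fun _ : ι => p) * diagRep (fun _ : ι => π) a =
      diagRep (fun _ : ι => π) a * diagOp fun _ : ι => p := by
    intro a
    ext x i
    exact DFunLike.congr_fun (hpA a) (x i)
  have h3 : ∀ T, (∀ a, T * diagRep (fun _ : ι => π) a = diagRep (fun _ : ι => π) a * T) →
      diagOp (fun _ : ι => p) * T = T * diagOp fun _ : ι => p := by
    intro T hT
    -- the matrix entries of `T` commute with `π(A)`, hence with `p`
    let inc : ι → E →L[ℂ] PiLp 2 (fun _ : ι => E) := fun j =>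
      ((PiLp.continuousLinearEquiv 2 ℂ fun _ : ι => E).symm : (ι → E) →L[ℂ] _) ∘L
        ContinuousLinearMap.single ℂ (fun _ : ι => E) j
    have hinc : ∀ j (w : E), inc j w = WithLp.toLp 2 (Pi.single j w) := fun j w => rfl
    have hdiag : ∀ (S : E →L[ℂ] E) j w, diagOp (fun _ : ι => S) (inc j w) = inc j (S w) := by
      intro S j w
      ext i
      rw [diagOp_apply, hinc, hinc]
      by_cases h : i = j
      · subst h
        simp
      · simp [h]
    have hsum : ∀ x : PiLp 2 (fun _ : ι => E), x = ∑ j, inc j (x j) := fun x => by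
      ext i
      simp [hinc, Finset.sum_pi_single]
    have hentry : ∀ i j (w : E), T (inc j (p w)) i = p (T (inc j w) i) := fun i j w => by
      let S : E →L[ℂ] E := PiLp.proj 2 (fun _ : ι => E) i ∘L T ∘L inc j
      have hS : ∀ a, S * π a = π a * S := fun a => by
        ext w
        have := DFunLike.congr_fun (hT a) (inc j w)
        have h2 : T (inc j (π a w)) = diagRep (fun _ : ι => π) a (T (inc j w)) := by
          rw [← hdiag]
          exact this
        change T (inc j (π a w)) i = _
        rw [h2]
        rfl
      exact (DFunLike.congr_fun (hpc S hS) w).symm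
    ext x i
    change p (T x i) = T (diagOp (fun _ : ι => p) x) i
    conv_lhs => rw [hsum x]
    conv_rhs => rw [hsum x]
    simp only [map_sum, hdiag]
    rw [WithLp.ofLp_sum, WithLp.ofLp_sum, Finset.sum_apply, Finset.sum_apply, map_sum]
    exact Finset.sum_congr rfl fun j _ => (hentry i j _).symm
  have h4 : ∀ y, (∀ x ∈ J.toIdeal, ∀ w, ⟪y, diagRep (fun _ : ι => π) x w⟫_ℂ = 0) →
      diagOp (fun _ : ι => p) y = 0 := by
    intro y hy
    ext i
    refine hpJ (y i) fun x hx w => ?_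
    have := hy x hx (WithLp.toLp 2 (Pi.single i w))
    rw [PiLp.inner_apply, Finset.sum_eq_single i] at this
    · simpa [diagRep_apply] using this
    · intro j _ hj
      simp [diagRep_apply, hj]
    · simp
  obtain ⟨k, hk, hkv⟩ := exists_mem_ideal_approx_vector J (diagRep fun _ : ι => π)
    (diagOp fun _ : ι => p) h1 h2 h3 h4 (WithLp.toLp 2 v) hε
  refine ⟨k, hk, fun i => lt_of_le_of_lt ?_ hkv⟩
  exact PiLp.norm_apply_le (diagRep (fun _ : ι => π) k (WithLp.toLp 2 v) -
    diagOp (fun _ : ι => p) (WithLp.toLp 2 v)) i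

end Representations

/-! ### Tracial functionals that are sums of commutators with functionals -/

section Traces

universe u

variable {A : Type u} [CStarAlgebra A] [PartialOrder A] [StarOrderedRing A]

/-- Finitely many positive functionals are vector functionals of one representation, namely the
direct sum of their GNS representations. -/
theorem exists_common_representation {κ : Type} [Fintype κ] (Ω : κ → (A →ₚ[ℂ] ℂ)) :
    ∃ (E : Type u) (_ : NormedAddCommGroup E) (_ : InnerProductSpace ℂ E) (_ : CompleteSpace E)
      (π : A →⋆ₐ[ℂ] (E →L[ℂ] E)) (ξ : κ → E), ∀ i a, Ω i a = ⟪ξ i, π a (ξ i)⟫_ℂ := by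
  classical
  refine ⟨PiLp 2 fun i => (Ω i).GNS, inferInstance, inferInstance, inferInstance,
    diagRep fun i => (Ω i).gnsStarAlgHom,
    fun i => WithLp.toLp 2 (Pi.single i (((Ω i).toPreGNS 1 : (Ω i).PreGNS) : (Ω i).GNS)),
    fun i a => ?_⟩
  rw [PiLp.inner_apply, Finset.sum_eq_single i]
  · rw [diagRep_apply]
    simp only [Pi.single_eq_same]
    change _ = ⟪(((Ω i).toPreGNS 1 : (Ω i).PreGNS) : (Ω i).GNS), (Ω i).gnsNonUnitalStarAlgHom a
      (((Ω i).toPreGNS 1 : (Ω i).PreGNS) : (Ω i).GNS)⟫_ℂ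
    rw [PositiveLinearMap.gnsNonUnitalStarAlgHom_apply_coe, UniformSpace.Completion.inner_coe,
      PositiveLinearMap.preGNS_inner_def]
    simp
  · intro j _ hj
    simp [hj]
  · simp

/-- Let `ω₁`, `ω₂` be the vector functionals of `ξ₁`, `ξ₂`, with `ω₂` tracial, asymptotically
orthogonal along positive contractions in `J`. The projection onto the closed span of the vectors
`π(a) T ξ₁`, for `T` in the commutant, is in the centre of `π(A)''`, lives on `π(J) E`, and
separates `ξ₁` from `ξ₂`. -/
theorem exists_separating_projection {E : Type*} [NormedAddCommGroup E] [InnerProductSpace ℂ E]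
    [CompleteSpace E] (J : ClosedIdeal A) (π : A →⋆ₐ[ℂ] (E →L[ℂ] E)) (ω₁ ω₂ : A →ₚ[ℂ] ℂ)
    (ξ₁ ξ₂ : E) (hξ₁ : ∀ a, ω₁ a = ⟪ξ₁, π a ξ₁⟫_ℂ) (hξ₂ : ∀ a, ω₂ a = ⟪ξ₂, π a ξ₂⟫_ℂ)
    (htr : ∀ a b, ω₂ (a * b) = ω₂ (b * a))
    (horth : ∀ ε : ℝ, 0 < ε →
      ∃ e ∈ J.toIdeal, 0 ≤ e ∧ e ≤ 1 ∧ (ω₁ (1 - e)).re ≤ ε ∧ (ω₂ e).re ≤ ε) :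
    ∃ p : E →L[ℂ] E, p * p = p ∧ (∀ a, p * π a = π a * p) ∧
      (∀ T : E →L[ℂ] E, (∀ a, T * π a = π a * T) → p * T = T * p) ∧
      (∀ y, (∀ x ∈ J.toIdeal, ∀ v, ⟪y, π x v⟫_ℂ = 0) → p y = 0) ∧ p ξ₁ = ξ₁ ∧ p ξ₂ = 0 := by
  let G : Set E := {w | ∃ a : A, ∃ T : E →L[ℂ] E, (∀ b, T * π b = π b * T) ∧ w = π a (T ξ₁)}
  let W : Submodule ℂ E := (Submodule.span ℂ G).topologicalClosure
  have hWcl : IsClosed (W : Set E) := Submodule.isClosed_topologicalClosure _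
  have : CompleteSpace W := hWcl.completeSpace_coe
  have hGW : ∀ w ∈ G, w ∈ W := fun w hw => subset_closure (Submodule.subset_span hw)
  have hinv : ∀ S : E →L[ℂ] E, (∀ w ∈ G, S w ∈ G) → ∀ w ∈ W, S w ∈ W := fun S hS w hw => by
    refine map_mem_closure S.continuous hw fun x hx => ?_
    have : Submodule.span ℂ G ≤ (Submodule.span ℂ G).comap (S : E →ₗ[ℂ] E) :=
      Submodule.span_le.2 fun w hw => Submodule.subset_span (hS w hw)
    exact this hx
  have hperp : ∀ y, (∀ w ∈ G, ⟪w, y⟫_ℂ = 0) → y ∈ Wᗮ := fun y hy => by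
    rw [Submodule.orthogonal_closure, Submodule.mem_orthogonal]
    intro w hw
    induction hw using Submodule.span_induction with
    | mem w hw => exact hy w hw
    | zero => simp
    | add v w _ _ h1 h2 => rw [inner_add_left, h1, h2, add_zero]
    | smul z v _ h => rw [inner_smul_left, h, mul_zero]
  have hGA : ∀ a, ∀ w ∈ G, π a w ∈ G := by
    rintro a _ ⟨b, T, hT, rfl⟩
    exact ⟨a * b, T, hT, by rw [map_mul]; rfl⟩
  have hGT : ∀ S : E →L[ℂ] E, (∀ a, S * π a = π a * S) → ∀ w ∈ G, S w ∈ G := by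
    rintro S hS _ ⟨b, T, hT, rfl⟩
    refine ⟨b, S * T, fun a => by rw [mul_assoc, hT, ← mul_assoc, hS, mul_assoc], ?_⟩
    exact DFunLike.congr_fun (hS b) _
  have hvec : ∀ (ω : A →ₚ[ℂ] ℂ) (ξ : E), (∀ a, ω a = ⟪ξ, π a ξ⟫_ℂ) → ∀ (f : A) (ε : ℝ), 0 ≤ f →
      f ≤ 1 → (ω f).re ≤ ε → ‖π f ξ‖ ≤ √ε := fun ω ξ hξ f ε h0 h1 hf => by
    refine Real.le_sqrt_of_sq_le (le_trans (le_of_eq ?_)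
      ((re_apply_mono ω (mul_self_le_self h0 h1)).trans hf))
    have hs : star f = f := (IsSelfAdjoint.of_nonneg h0).star_eq
    rw [hξ, map_mul]
    change _ = (⟪ξ, π f (π f ξ)⟫_ℂ).re
    rw [inner_rep_right, hs, inner_self_eq_norm_sq_to_K]
    norm_cast
  -- for `e` in `J` with `e ξ₁` near `ξ₁`, the vector `π(a) T ξ₁` is near `π(a e) T ξ₁`
  have happ : ∀ (a e : A) (T : E →L[ℂ] E) (ε : ℝ), (∀ b, T * π b = π b * T) → 0 ≤ e → e ≤ 1 →
      (ω₁ (1 - e)).re ≤ ε → ‖π a (T ξ₁) - π (a * e) (T ξ₁)‖ ≤ √ε * (‖π a‖ * ‖T‖) := by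
    intro a e T ε hT h0 h1 he
    have h2 : π a (T ξ₁) - π (a * e) (T ξ₁) = π a (T (π (1 - e) ξ₁)) := by
      have h3 : T (π (1 - e) ξ₁) = π (1 - e) (T ξ₁) := DFunLike.congr_fun (hT (1 - e)) ξ₁
      rw [h3, map_mul, map_sub, map_one]
      change _ = π a (T ξ₁ - π e (T ξ₁))
      rw [map_sub]
      rfl
    rw [h2]
    have h4 := hvec ω₁ ξ₁ hξ₁ (1 - e) ε (sub_nonneg.2 h1) (by simpa using h0) he
    calc ‖π a (T (π (1 - e) ξ₁))‖ ≤ ‖π a‖ * (‖T‖ * ‖π (1 - e) ξ₁‖) :=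
          (π a).le_opNorm_of_le (T.le_opNorm _)
      _ ≤ ‖π a‖ * (‖T‖ * √ε) := by gcongr
      _ = _ := by ring
  refine ⟨W.starProjection, W.isIdempotentElem_starProjection, fun a => ?_, fun T hT => ?_,
    fun y hy => ?_, ?_, ?_⟩
  · refine starProjection_commute W _ (hinv _ (hGA a)) ?_
    rw [← ContinuousLinearMap.star_eq_adjoint, ← map_star]
    exact hinv _ (hGA (star a))
  · refine starProjection_commute W _ (hinv _ (hGT T hT)) ?_
    rw [← ContinuousLinearMap.star_eq_adjoint]
    exact hinv _ (hGT _ (adjoint_commutes π hT))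
  · refine (W.starProjection_apply_eq_zero_iff).2 (hperp y ?_)
    rintro _ ⟨a, T, hT, rfl⟩
    refine eq_zero_of_norm_le_sqrt_mul (‖π a‖ * ‖T‖ * ‖y‖) fun ε hε => ?_
    obtain ⟨e, heJ, h0, h1, he, -⟩ := horth ε hε
    have h2 : ⟪π (a * e) (T ξ₁), y⟫_ℂ = 0 := by
      rw [← inner_conj_symm, hy _ (J.toIdeal.mul_mem_left a heJ), map_zero]
    have h3 : ⟪π a (T ξ₁), y⟫_ℂ = ⟪π a (T ξ₁) - π (a * e) (T ξ₁), y⟫_ℂ := by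
      rw [inner_sub_left, h2, sub_zero]
    rw [h3, ← mul_assoc]
    exact (norm_inner_le_norm _ _).trans
      (mul_le_mul_of_nonneg_right (happ a e T ε hT h0 h1 he) (norm_nonneg y))
  · refine W.starProjection_eq_self_iff.2 (hGW _ ⟨1, 1, fun b => by simp, by simp⟩)
  · refine (W.starProjection_apply_eq_zero_iff).2 (hperp ξ₂ ?_)
    rintro _ ⟨a, T, hT, rfl⟩
    refine eq_zero_of_norm_le_sqrt_mul (‖π a‖ * ‖T‖ * ‖ξ₂‖ + ‖T ξ₁‖ * ‖π a‖) fun ε hε => ?_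
    obtain ⟨e, heJ, h0, h1, he, he'⟩ := horth ε hε
    have hs : star e = e := (IsSelfAdjoint.of_nonneg h0).star_eq
    -- by traciality `e a⋆ ξ₂` is as small as `a e ξ₂`
    have h2 : ‖π (star (a * e)) ξ₂‖ = ‖π (a * e) ξ₂‖ := by
      rw [← sq_eq_sq₀ (norm_nonneg _) (norm_nonneg _)]
      have e1 := htr (a * e) (star (a * e))
      rw [hξ₂, hξ₂, map_mul π (a * e), map_mul π (star (a * e))] at e1
      change ⟪ξ₂, π (a * e) (π (star (a * e)) ξ₂)⟫_ℂ = ⟪ξ₂, π (star (a * e)) (π (a * e) ξ₂)⟫_ℂ at e1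
      rw [inner_rep_right π (a * e), inner_self_eq_norm_sq_to_K,
        inner_rep_right π (star (a * e)), star_star, inner_self_eq_norm_sq_to_K] at e1
      exact_mod_cast e1
    have h3 : ‖π (a * e) ξ₂‖ ≤ ‖π a‖ * √ε := by
      rw [map_mul]
      exact (π a).le_opNorm_of_le (hvec ω₂ ξ₂ hξ₂ e ε h0 h1 he')
    have h4 : ‖⟪π (a * e) (T ξ₁), ξ₂⟫_ℂ‖ ≤ ‖T ξ₁‖ * (‖π a‖ * √ε) := by
      rw [inner_rep_left]
      exact (norm_inner_le_norm _ _).trans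
        (mul_le_mul_of_nonneg_left (h2.le.trans h3) (norm_nonneg _))
    have h5 : ‖⟪π a (T ξ₁) - π (a * e) (T ξ₁), ξ₂⟫_ℂ‖ ≤ √ε * (‖π a‖ * ‖T‖) * ‖ξ₂‖ :=
      (norm_inner_le_norm _ _).trans
        (mul_le_mul_of_nonneg_right (happ a e T ε hT h0 h1 he) (norm_nonneg _))
    calc ‖⟪π a (T ξ₁), ξ₂⟫_ℂ‖
        = ‖⟪π a (T ξ₁) - π (a * e) (T ξ₁), ξ₂⟫_ℂ + ⟪π (a * e) (T ξ₁), ξ₂⟫_ℂ‖ := by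
          rw [← inner_add_left, sub_add_cancel]
      _ ≤ _ := norm_add_le _ _
      _ ≤ √ε * (‖π a‖ * ‖T‖) * ‖ξ₂‖ + ‖T ξ₁‖ * (‖π a‖ * √ε) := add_le_add h5 h4
      _ = _ := by ring

/-- If `ω₁ - ω₂` is on `J` a sum of commutators of elements of `A` with functionals, then `ω₁ = 0`:
a central projection separating `ω₁` from `ω₂` is approximated by elements of `J` on which sums of
commutators almost vanish. -/
theorem eq_zero_of_sum_commutators (J : ClosedIdeal A) (ω₁ ω₂ : A →ₚ[ℂ] ℂ)
    (htr : ∀ a b, ω₂ (a * b) = ω₂ (b * a))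
    (horth : ∀ ε : ℝ, 0 < ε →
      ∃ e ∈ J.toIdeal, 0 ≤ e ∧ e ≤ 1 ∧ (ω₁ (1 - e)).re ≤ ε ∧ (ω₂ e).re ≤ ε)
    {n : ℕ} (c : Fin n → ℂ) (ω : Fin n → (A →ₚ[ℂ] ℂ)) (b : Fin n → A)
    (h : ∀ x ∈ J.toIdeal, ω₁ x - ω₂ x = ∑ i, c i * ω i (x * b i - b i * x)) (a : A) :
    ω₁ a = 0 := by
  obtain ⟨E, _, _, _, π, ξ, hξ⟩ := exists_common_representation (κ := Bool ⊕ Fin n)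
    (Sum.elim (fun i => if i then ω₁ else ω₂) ω)
  set ξ₁ := ξ (Sum.inl true)
  set ξ₂ := ξ (Sum.inl false)
  have hξ₁ : ∀ a, ω₁ a = ⟪ξ₁, π a ξ₁⟫_ℂ := fun a => hξ (Sum.inl true) a
  have hξ₂ : ∀ a, ω₂ a = ⟪ξ₂, π a ξ₂⟫_ℂ := fun a => hξ (Sum.inl false) a
  have hη : ∀ i a, ω i a = ⟪ξ (Sum.inr i), π a (ξ (Sum.inr i))⟫_ℂ := fun i a => hξ (Sum.inr i) a
  obtain ⟨p, hp, hpA, hpc, hpJ, hp₁, hp₂⟩ :=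
    exists_separating_projection J π ω₁ ω₂ ξ₁ ξ₂ hξ₁ hξ₂ htr horth
  have hz : ‖ξ₁‖ ^ 2 = 0 := by
    set C : ℝ := ‖ξ₁‖ + ‖ξ₂‖ +
      ∑ i, ‖c i‖ * (‖ξ (Sum.inr i)‖ + ‖π (star (b i)) (ξ (Sum.inr i))‖) with hC
    refine norm_le_zero_iff.1 (le_of_forall_pos_le_add fun δ hδ => ?_)
    have hC0 : 0 ≤ C := by positivity
    obtain ⟨k, hkJ, hk⟩ := exists_mem_ideal_approx J π p hp hpA hpc hpJ
      (Sum.elim ξ fun i : Fin n => π (b i) (ξ (Sum.inr i))) (show 0 < δ / (C + 1) by positivity)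
    set η := δ / (C + 1) with hηd
    have hin : ∀ v w : E, ‖π k w - p w‖ < η → ‖⟪v, π k w⟫_ℂ - ⟪v, p w⟫_ℂ‖ ≤ ‖v‖ * η :=
      fun v w hw => by
        rw [← inner_sub_right]
        exact (norm_inner_le_norm _ _).trans (by gcongr)
    have b1 := hin ξ₁ ξ₁ (hk (Sum.inl (Sum.inl true)))
    have b2 := hin ξ₂ ξ₂ (hk (Sum.inl (Sum.inl false)))
    rw [hp₁, ← hξ₁, inner_self_eq_norm_sq_to_K] at b1
    rw [hp₂, ← hξ₂, inner_zero_right, sub_zero] at b2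
    have b3 : ∀ i, ‖ω i (k * b i - b i * k)‖
        ≤ (‖ξ (Sum.inr i)‖ + ‖π (star (b i)) (ξ (Sum.inr i))‖) * η := fun i => by
      set ζ := ξ (Sum.inr i)
      have e1 : ω i (k * b i - b i * k)
          = (⟪ζ, π k (π (b i) ζ)⟫_ℂ - ⟪ζ, p (π (b i) ζ)⟫_ℂ)
            - (⟪π (star (b i)) ζ, π k ζ⟫_ℂ - ⟪π (star (b i)) ζ, p ζ⟫_ℂ) := by
        have e2 : ⟪ζ, p (π (b i) ζ)⟫_ℂ = ⟪π (star (b i)) ζ, p ζ⟫_ℂ := by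
          rw [← inner_rep_right]
          exact congrArg _ (DFunLike.congr_fun (hpA (b i)) ζ)
        rw [e2, sub_sub_sub_cancel_right, ← inner_rep_right, map_sub, hη, hη, map_mul, map_mul]
        rfl
      rw [e1, add_mul]
      exact (norm_sub_le _ _).trans (add_le_add (hin _ _ (hk (Sum.inr i)))
        (hin _ _ (hk (Sum.inl (Sum.inr i)))))
    have b4 : ‖ω₁ k - ω₂ k‖
        ≤ (∑ i, ‖c i‖ * (‖ξ (Sum.inr i)‖ + ‖π (star (b i)) (ξ (Sum.inr i))‖)) * η := by
      rw [h k hkJ, Finset.sum_mul]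
      refine (norm_sum_le _ _).trans (Finset.sum_le_sum fun i _ => ?_)
      rw [norm_mul, mul_assoc]
      exact mul_le_mul_of_nonneg_left (b3 i) (norm_nonneg _)
    have e3 : ‖(‖ξ₁‖ ^ 2 : ℝ)‖ = ‖(RCLike.ofReal ‖ξ₁‖ : ℂ) ^ 2‖ := by simp
    rw [e3, zero_add]
    calc ‖(RCLike.ofReal ‖ξ₁‖ : ℂ) ^ 2‖
        = ‖(ω₁ k - ω₂ k) - (ω₁ k - (RCLike.ofReal ‖ξ₁‖ : ℂ) ^ 2) + ω₂ k‖ := by congr 1; ring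
      _ ≤ ‖ω₁ k - ω₂ k‖ + ‖ω₁ k - (RCLike.ofReal ‖ξ₁‖ : ℂ) ^ 2‖ + ‖ω₂ k‖ :=
          (norm_add_le _ _).trans (add_le_add_left (norm_sub_le _ _) _)
      _ ≤ C * η := by rw [hC]; linarith
      _ ≤ δ := by
          rw [hηd, mul_div_assoc', div_le_iff₀ (by positivity)]
          nlinarith
  have h0 : ξ₁ = 0 := by simpa using hz
  rw [hξ₁, h0, inner_zero_left]

/-- The functionals spanned by `x ↦ ω (x b - b x)` for `ω` positive. -/
def commutatorFunctionals (A : Type*) [CStarAlgebra A] [PartialOrder A] [StarOrderedRing A] :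
    Submodule ℂ (StrongDual ℂ A) :=
  Submodule.span ℂ {φ | ∃ (ω : A →ₚ[ℂ] ℂ) (b : A), ∀ x, φ x = ω (x * b - b * x)}

theorem starDual_mem_commutatorFunctionals {g : StrongDual ℂ A}
    (hg : g ∈ commutatorFunctionals A) : starDual g ∈ commutatorFunctionals A := by
  induction hg using Submodule.span_induction with
  | mem φ h =>
    obtain ⟨ω, b, h⟩ := h
    rw [← neg_neg (starDual φ)]
    refine Submodule.neg_mem _ (Submodule.subset_span ⟨ω, star b, fun x => ?_⟩)
    rw [neg_apply, starDual_apply, h, ← Complex.star_def, ← map_star,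
      ← map_neg]
    congr 1
    simp [star_sub, star_mul]
  | zero =>
    convert Submodule.zero_mem (commutatorFunctionals A)
    ext x
    simp [starDual_apply]
  | add x y _ _ h1 h2 =>
    convert Submodule.add_mem _ h1 h2
    ext x
    simp [starDual_apply]
  | smul z x _ h =>
    convert Submodule.smul_mem _ (conj z) h
    ext x
    simp [starDual_apply]

omit [PartialOrder A] [StarOrderedRing A] in
theorem exists_hermitian_parts (f : StrongDual ℂ A) :
    ∃ f₁ f₂ : StrongDual ℂ A, (∀ x, f₁ (star x) = conj (f₁ x)) ∧
      (∀ x, f₂ (star x) = conj (f₂ x)) ∧ f = f₁ + Complex.I • f₂ ∧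
      f₁ = (2⁻¹ : ℂ) • (f + starDual f) ∧ f₂ = (-2⁻¹ * Complex.I : ℂ) • (f - starDual f) := by
  have h2 : conj (2 : ℂ) = 2 := map_ofNat _ 2
  refine ⟨(2⁻¹ : ℂ) • (f + starDual f), (-2⁻¹ * Complex.I : ℂ) • (f - starDual f), fun x => ?_,
    fun x => ?_, ?_, rfl, rfl⟩
  · simp only [smul_apply, add_apply, starDual_apply,
      smul_eq_mul, star_star, map_mul, map_add, map_inv₀, h2, Complex.conj_conj]
    ring
  · simp only [smul_apply, sub_apply, starDual_apply,
      smul_eq_mul, star_star, map_mul, map_sub, map_neg, map_inv₀, h2, Complex.conj_conj,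
      Complex.conj_I]
    ring
  · ext x
    simp only [smul_apply, sub_apply,
      add_apply, smul_eq_mul]
    linear_combination (1 / 2 * (f x - starDual f x)) * Complex.I_mul_I

/-- By the Jordan decomposition, commutators of elements of `A` with arbitrary bounded functionals
lie in `commutatorFunctionals A`. -/
theorem mem_commutatorFunctionals (f : StrongDual ℂ A) (b : A) {g : StrongDual ℂ A}
    (h : ∀ x, g x = f (x * b - b * x)) : g ∈ commutatorFunctionals A := by
  let ad : A →L[ℂ] A := (ContinuousLinearMap.mul ℂ A).flip b - ContinuousLinearMap.mul ℂ A b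
  have hherm : ∀ k : StrongDual ℂ A, (∀ x, k (star x) = conj (k x)) →
      k.comp ad ∈ commutatorFunctionals A := fun k hk => by
    obtain ⟨ω₁, ω₂, hω, -⟩ := exists_jordan_decomposition k hk
    let pos : (A →ₚ[ℂ] ℂ) → StrongDual ℂ A := fun ω => ⟨ω.toLinearMap, map_continuous ω⟩
    have hpos : ∀ ω, (pos ω).comp ad ∈ commutatorFunctionals A := fun ω =>
      Submodule.subset_span ⟨ω, b, fun x => rfl⟩
    convert Submodule.sub_mem _ (hpos ω₁) (hpos ω₂)
    ext x
    exact hω _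
  obtain ⟨f₁, f₂, h1, h2, hf, -⟩ := exists_hermitian_parts f
  have : g = f₁.comp ad + Complex.I • f₂.comp ad := by
    ext x
    rw [h, hf]
    rfl
  rw [this]
  exact Submodule.add_mem _ (hherm f₁ h1) (Submodule.smul_mem _ _ (hherm f₂ h2))

/-- A sum of commutators of elements of `A` with functionals that is tracial on the closed ideal `J`
vanishes on `J`. -/
theorem tracial_commutatorFunctional_eq_zero (J : ClosedIdeal A) {g : StrongDual ℂ A}
    (hg : g ∈ commutatorFunctionals A) (hJ : ∀ x ∈ J.toIdeal, ∀ a, g (x * a) = g (a * x))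
    {x : A} (hx : x ∈ J.toIdeal) : g x = 0 := by
  have hherm : ∀ k : StrongDual ℂ A, k ∈ commutatorFunctionals A →
      (∀ x, k (star x) = conj (k x)) → (∀ x ∈ J.toIdeal, ∀ a, k (x * a) = k (a * x)) →
      k x = 0 := by
    intro k hkD hk hkJ
    obtain ⟨ω₁, ω₂, hω, t1, t2, o1, o2⟩ := exists_tracial_jordan_decomposition J k hk hkJ
    obtain ⟨n, c, φ, hsum⟩ := (Submodule.mem_span_set').1 hkD
    choose ω b hφ using fun i => (φ i).2
    have hkx : ∀ y, k y = ∑ i, c i * ω i (y * b i - b i * y) := fun y => by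
      rw [← hsum, sum_apply]
      exact Finset.sum_congr rfl fun i _ => congrArg (c i * ·) (hφ i y)
    rw [hω x hx, eq_zero_of_sum_commutators J ω₁ ω₂ t2 o1 c ω b
      (fun y hy => by rw [← hω y hy, hkx]),
      eq_zero_of_sum_commutators J ω₂ ω₁ t1 o2 (fun i => -c i) ω b
      (fun y hy => by
        rw [← neg_sub, ← hω y hy, hkx, ← Finset.sum_neg_distrib]
        simp), sub_zero]
  obtain ⟨f₁, f₂, h1, h2, hf, e1, e2⟩ := exists_hermitian_parts g
  have hs := starDual_mem_commutatorFunctionals hg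
  have hsJ : ∀ x ∈ J.toIdeal, ∀ a, starDual g (x * a) = starDual g (a * x) := fun x hx a => by
    rw [starDual_apply, starDual_apply, star_mul, star_mul, hJ _ (J.star_mem hx)]
  have z1 := hherm f₁ (e1 ▸ Submodule.smul_mem _ _ (Submodule.add_mem _ hg hs)) h1
    (fun x hx a => by
      rw [e1]
      simp only [smul_apply, add_apply, hJ x hx, hsJ x hx])
  have z2 := hherm f₂ (e2 ▸ Submodule.smul_mem _ _ (Submodule.sub_mem _ hg hs)) h2
    (fun x hx a => by
      rw [e2]
      simp only [smul_apply, sub_apply, hJ x hx, hsJ x hx])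
  rw [hf, add_apply, smul_apply, z1, z2]
  simp

end Traces

/-! ### Approximation of inner derivations -/

section HahnBanach

variable {A : Type*} [CStarAlgebra A]

theorem exists_dual_separating {𝕜 V : Type*} [RCLike 𝕜] [NormedAddCommGroup V] [NormedSpace 𝕜 V]
    (W : Submodule 𝕜 V) {x : V} (hx : x ∉ closure (W : Set V)) :
    ∃ f : StrongDual 𝕜 V, (∀ y ∈ W, f y = 0) ∧ f x ≠ 0 := by
  let C := W.topologicalClosure
  have : IsClosed (C : Set V) := W.isClosed_topologicalClosure
  obtain ⟨f, hf⟩ := SeparatingDual.exists_ne_zero (R := 𝕜) (x := C.mkQ x) (by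
    rw [Submodule.mkQ_apply, Ne, Submodule.Quotient.mk_eq_zero]
    exact hx)
  refine ⟨f.comp C.mkQL, fun y hy => ?_, hf⟩
  change f (C.mkQ y) = 0
  rw [Submodule.mkQ_apply, (Submodule.Quotient.mk_eq_zero C).2 (subset_closure hy), map_zero]

/-- If `[J, A] ⊆ L`, then every inner derivation by an element of `J` is a pointwise limit of
derivations by elements of `L`. -/
theorem exists_approx_derivation (J : ClosedIdeal A) (L : Submodule ℂ A)
    (hL : ∀ x ∈ J.toIdeal, ∀ a, ⁅x, a⁆ ∈ L) {x : A} (hx : x ∈ J.toIdeal) (F : Finset A) {ε : ℝ}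
    (hε : 0 < ε) : ∃ y ∈ L, ∀ b ∈ F, ‖⁅y, b⁆ - ⁅x, b⁆‖ ≤ ε := by
  classical
  let _ : PartialOrder A := CStarAlgebra.spectralOrder A
  have _ : StarOrderedRing A := CStarAlgebra.spectralOrderedRing A
  let Γ : A →L[ℂ] (F → A) := ContinuousLinearMap.pi fun b =>
    (ContinuousLinearMap.mul ℂ A).flip b - ContinuousLinearMap.mul ℂ A b
  have hΓ : ∀ y (b : F), Γ y b = ⁅y, (b : A)⁆ := fun y b => rfl
  have hcl : Γ x ∈ closure ((L.map (Γ : A →ₗ[ℂ] F → A) : Submodule ℂ (F → A)) : Set (F → A)) := by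
    -- a functional separating `[x, ·]` from the derivations of `L` would be tracial on `J`
    by_contra hcon
    obtain ⟨f, hf0, hfx⟩ := exists_dual_separating _ hcon
    let g : StrongDual ℂ A := f.comp Γ
    have hg : g ∈ commutatorFunctionals A := by
      let h : F → StrongDual ℂ A := fun b => (f.comp (ContinuousLinearMap.single ℂ (fun _ => A) b)).comp
        ((ContinuousLinearMap.mul ℂ A).flip b - ContinuousLinearMap.mul ℂ A b)
      have e : g = ∑ b, h b := by
        ext y
        rw [sum_apply]
        change f (Γ y) = ∑ b, f (Pi.single b (Γ y b))
        rw [← map_sum, Finset.univ_sum_single]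
      rw [e]
      exact Submodule.sum_mem _ fun b _ =>
        mem_commutatorFunctionals (f.comp (ContinuousLinearMap.single ℂ (fun _ => A) b)) b
          fun y => rfl
    refine hfx (tracial_commutatorFunctional_eq_zero J hg (fun y hy a => ?_) hx)
    have := hf0 _ ⟨⁅y, a⁆, hL y hy a, rfl⟩
    rw [← sub_eq_zero, ← map_sub, ← Ring.lie_def]
    exact this
  obtain ⟨_, ⟨y, hy, rfl⟩, hd⟩ := Metric.mem_closure_iff.1 hcl ε hε
  refine ⟨y, hy, fun b hb => ?_⟩
  rw [← dist_eq_norm, dist_comm]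
  exact (dist_le_pi_dist (Γ x) (Γ y) ⟨b, hb⟩).trans hd.le

end HahnBanach

/-! ### One-parameter groups of inner automorphisms -/

section Flow

variable {A : Type*} [CStarAlgebra A]

open selfAdjoint

/-- A closed set of automorphisms contains all its pointwise limits. -/
theorem mem_of_forall_approx {S : Set (A ≃⋆ₐ[ℂ] A)} (hS : IsClosed S) (φ : A ≃⋆ₐ[ℂ] A)
    (h : ∀ (F : Finset A) (ε : ℝ), 0 < ε → ∃ ψ ∈ S, ∀ b ∈ F, ‖ψ b - φ b‖ < ε) : φ ∈ S := by
  rw [← hS.closure_eq]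
  refine closure_induced.2 (mem_closure_iff.2 fun o ho hφ => ?_)
  obtain ⟨F, u, hu, hsub⟩ := isOpen_pi_iff.1 ho _ hφ
  have hev : ∀ᶠ ε : ℝ in 𝓝[>] 0, ∀ a ∈ F, Metric.ball (φ a) ε ⊆ u a := by
    refine (Filter.eventually_all_finset F).2 fun a ha => ?_
    obtain ⟨r, hr, hball⟩ := Metric.isOpen_iff.1 (hu a ha).1 _ (hu a ha).2
    filter_upwards [Ioo_mem_nhdsGT hr] with ε hε
    exact (Metric.ball_subset_ball hε.2.le).trans hball
  obtain ⟨ε, hε, hε0⟩ := (hev.and self_mem_nhdsWithin).exists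
  obtain ⟨ψ, hψ, hclose⟩ := h F ε hε0
  exact ⟨_, hsub fun a ha => hε a ha (mem_ball_iff_norm.2 (hclose a ha)), ψ, hψ, rfl⟩

theorem aut_norm (φ : A ≃⋆ₐ[ℂ] A) (x : A) : ‖φ x‖ = ‖x‖ :=
  (StarAlgEquiv.isometry φ).norm_map_of_map_zero (map_zero φ) x

theorem aut_inv_apply_self (φ : A ≃⋆ₐ[ℂ] A) (x : A) : φ⁻¹ (φ x) = x := φ.symm_apply_apply x

theorem aut_apply_inv_self (φ : A ≃⋆ₐ[ℂ] A) (x : A) : φ (φ⁻¹ x) = x := φ.apply_symm_apply x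

theorem aut_mul_apply (φ ψ : A ≃⋆ₐ[ℂ] A) (x : A) : (φ * ψ) x = φ (ψ x) := rfl

theorem aut_one_apply (x : A) : (1 : A ≃⋆ₐ[ℂ] A) x = x := rfl

theorem aut_lie (φ : A ≃⋆ₐ[ℂ] A) (x y : A) : φ ⁅x, y⁆ = ⁅φ x, φ y⁆ := by
  rw [Ring.lie_def, Ring.lie_def, map_sub, map_mul, map_mul]

theorem aut_real_smul (φ : A ≃⋆ₐ[ℂ] A) (s : ℝ) (x : A) : φ (s • x) = s • φ x := by
  rw [← Complex.coe_smul, ← Complex.coe_smul, map_smul]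

/-- The one-parameter group `t ↦ Ad(exp(i t h))` for selfadjoint `h`. -/
def flow (h : selfAdjoint A) (t : ℝ) : A ≃⋆ₐ[ℂ] A := Ad (expUnitary (t • h))

theorem flow_zero (h : selfAdjoint A) : flow h 0 = 1 := by
  rw [flow, zero_smul, expUnitary_zero, map_one]

theorem flow_add (h : selfAdjoint A) (s t : ℝ) : flow h (s + t) = flow h s * flow h t := by
  rw [flow, add_smul, Commute.expUnitary_add, map_mul]
  · rfl
  · exact ((Commute.refl (h : A)).smul_left s).smul_right t

theorem flow_neg (h : selfAdjoint A) (t : ℝ) : flow (-h) t = flow h (-t) := by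
  rw [flow, flow, smul_neg, neg_smul]

theorem flow_apply (h : selfAdjoint A) (t : ℝ) (b : A) :
    flow h t b = NormedSpace.exp (t • (Complex.I • (h : A))) * b *
      NormedSpace.exp (t • -(Complex.I • (h : A))) := by
  have h1 : ((expUnitary (t • h) : unitary A) : A) = NormedSpace.exp (t • (Complex.I • (h : A))) := by
    rw [expUnitary_coe, selfAdjoint.val_smul, smul_comm]
  rw [flow, Ad_apply, h1]
  congr 1
  rw [NormedSpace.star_exp]
  congr 1
  rw [star_smul, star_smul, h.2.star_eq, star_trivial]
  simp

theorem continuous_flow (h : selfAdjoint A) (b : A) : Continuous fun t => flow h t b := by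
  have hc : Continuous fun t : ℝ => ((expUnitary (t • h) : unitary A) : A) :=
    continuous_subtype_val.comp (continuous_expUnitary.comp (continuous_id.smul continuous_const))
  exact (hc.mul continuous_const).mul hc.star

theorem hasDerivAt_flow (h : selfAdjoint A) (b : A) :
    HasDerivAt (fun t => flow h t b) ⁅Complex.I • (h : A), b⁆ 0 := by
  have h1 := hasDerivAt_exp_smul_const (𝕂 := ℝ) (Complex.I • (h : A)) 0
  have h2 := hasDerivAt_exp_smul_const (𝕂 := ℝ) (-(Complex.I • (h : A))) 0
  have h3 := (h1.mul_const b).mul h2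
  simp only [zero_smul, NormedSpace.exp_zero, one_mul, mul_one] at h3
  rw [Ring.lie_def, sub_eq_add_neg, ← mul_neg]
  refine h3.congr_of_eventuallyEq (Eventually.of_forall fun t => flow_apply h t b)

theorem eventually_flow (h : selfAdjoint A) (F : Finset A) {ε : ℝ} (hε : 0 < ε) :
    ∀ᶠ s : ℝ in 𝓝[>] 0, ∀ b ∈ F, ‖flow h s b - (b + s • ⁅Complex.I • (h : A), b⁆)‖ ≤ ε * s := by
  refine (Filter.eventually_all_finset F).2 fun b _ => ?_
  have h1 := (hasDerivAt_iff_isLittleO.1 (hasDerivAt_flow h b)).bound hε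
  filter_upwards [nhdsWithin_le_nhds h1, self_mem_nhdsWithin] with s hs hs0
  rw [flow_zero, aut_one_apply, sub_zero, sub_sub, Real.norm_of_nonneg (le_of_lt hs0)] at hs
  exact hs

end Flow

/-! ### Tangent elements of a group of automorphisms -/

section Tangent

variable {A : Type*} [CStarAlgebra A] {H : Subgroup (A ≃⋆ₐ[ℂ] A)}

/-- The element `x` is tangent to `H` if for small `s > 0` some element of `H` agrees to first
order with `1 + s [x, ·]`, pointwise on `A`. -/
def IsTangent (H : Subgroup (A ≃⋆ₐ[ℂ] A)) (x : A) : Prop :=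
  ∀ (F : Finset A) (ε : ℝ), 0 < ε →
    ∀ᶠ s : ℝ in 𝓝[>] 0, ∃ φ ∈ H, ∀ b ∈ F, ‖φ b - (b + s • ⁅x, b⁆)‖ ≤ ε * s

/-- Tangency of `x` depends only on the derivation `[x, ·]`, and is closed under pointwise limits of
derivations. -/
theorem IsTangent.of_approx {x : A} (h : ∀ (F : Finset A) (ε : ℝ), 0 < ε →
    ∃ y : A, IsTangent H y ∧ ∀ b ∈ F, ‖⁅y, b⁆ - ⁅x, b⁆‖ ≤ ε) : IsTangent H x := by
  intro F ε hε
  obtain ⟨y, hy, hyx⟩ := h F (ε / 2) (by positivity)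
  filter_upwards [hy F (ε / 2) (by positivity), self_mem_nhdsWithin] with s ⟨φ, hφ, hs⟩ hs0
  refine ⟨φ, hφ, fun b hb => ?_⟩
  have h1 : φ b - (b + s • ⁅x, b⁆) = (φ b - (b + s • ⁅y, b⁆)) + s • (⁅y, b⁆ - ⁅x, b⁆) := by
    rw [smul_sub]
    abel
  have h2 : ‖s • (⁅y, b⁆ - ⁅x, b⁆)‖ ≤ s * (ε / 2) := by
    rw [norm_smul, Real.norm_of_nonneg (le_of_lt hs0)]
    exact mul_le_mul_of_nonneg_left (hyx b hb) (le_of_lt hs0)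
  rw [h1]
  exact (norm_add_le _ _).trans (by linarith [hs b hb])

theorem isClosed_setOf_isTangent (H : Subgroup (A ≃⋆ₐ[ℂ] A)) : IsClosed {x | IsTangent H x} := by
  refine isClosed_of_closure_subset fun x hx => ?_
  refine IsTangent.of_approx fun F ε hε => ?_
  have hev : ∀ᶠ y : A in 𝓝 x, ∀ b ∈ F, ‖⁅y, b⁆ - ⁅x, b⁆‖ < ε := by
    refine (Filter.eventually_all_finset F).2 fun b _ => ?_
    have hc : Continuous fun y : A => ‖⁅y, b⁆ - ⁅x, b⁆‖ := by
      simp only [Ring.lie_def]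
      fun_prop
    have := hc.tendsto x
    simp only [sub_self, norm_zero] at this
    exact this.eventually (gt_mem_nhds hε)
  obtain ⟨y, hy, hyt⟩ := (hev.and_frequently (mem_closure_iff_frequently.1 hx)).exists
  exact ⟨y, hyt, fun b hb => (hy b hb).le⟩

theorem IsTangent.zero (H : Subgroup (A ≃⋆ₐ[ℂ] A)) : IsTangent H 0 := by
  intro F ε hε
  filter_upwards [self_mem_nhdsWithin] with s hs
  refine ⟨1, H.one_mem, fun b _ => ?_⟩
  rw [zero_lie, smul_zero, add_zero, aut_one_apply, sub_self, norm_zero]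
  exact mul_nonneg hε.le (le_of_lt hs)

theorem IsTangent.add {x y : A} (hx : IsTangent H x) (hy : IsTangent H y) :
    IsTangent H (x + y) := by
  classical
  intro F ε hε
  filter_upwards [hx (F ∪ F.image fun b => ⁅y, b⁆) (ε / 4) (by positivity),
    hy F (ε / 4) (by positivity), self_mem_nhdsWithin, Ioo_mem_nhdsGT (show (0 : ℝ) < 1 by norm_num),
    (Filter.eventually_all_finset F).2 fun b _ => Ioo_mem_nhdsGT
      (show (0 : ℝ) < ε / (4 * (‖⁅x, ⁅y, b⁆⁆‖ + 1)) by positivity)]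
    with s ⟨φ, hφ, h1⟩ ⟨ψ, hψ, h2⟩ hs0 hs1 hs
  have hs0 : 0 < s := hs0
  refine ⟨φ * ψ, H.mul_mem hφ hψ, fun b hb => ?_⟩
  have a1 := h1 b (Finset.mem_union_left _ hb)
  have a2 := h2 b hb
  have a3 := h1 ⁅y, b⁆ (Finset.mem_union_right _ (Finset.mem_image_of_mem _ hb))
  have e : (φ * ψ) b - (b + s • ⁅x + y, b⁆) = φ (ψ b - (b + s • ⁅y, b⁆)) + (φ b - (b + s • ⁅x, b⁆))
      + s • (φ ⁅y, b⁆ - (⁅y, b⁆ + s • ⁅x, ⁅y, b⁆⁆)) + (s * s) • ⁅x, ⁅y, b⁆⁆ := by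
    rw [aut_mul_apply, map_sub, map_add, aut_real_smul, add_lie, smul_sub, smul_add, smul_add,
      mul_smul]
    abel
  have b1 : ‖φ (ψ b - (b + s • ⁅y, b⁆))‖ ≤ ε / 4 * s := by rwa [aut_norm]
  have b2 : ‖s • (φ ⁅y, b⁆ - (⁅y, b⁆ + s • ⁅x, ⁅y, b⁆⁆))‖ ≤ ε / 4 * s := by
    rw [norm_smul, Real.norm_of_nonneg hs0.le]
    have : s * (ε / 4 * s) ≤ ε / 4 * s := by
      have := mul_le_mul_of_nonneg_right hs1.2.le (show 0 ≤ ε / 4 * s by positivity)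
      linarith
    exact (mul_le_mul_of_nonneg_left a3 hs0.le).trans this
  have b3 : ‖(s * s) • ⁅x, ⁅y, b⁆⁆‖ ≤ ε / 4 * s := by
    rw [norm_smul, Real.norm_of_nonneg (by positivity), mul_assoc, mul_comm (ε / 4)]
    refine mul_le_mul_of_nonneg_left ?_ hs0.le
    have := (hs b hb).2
    rw [lt_div_iff₀ (by positivity)] at this
    nlinarith [norm_nonneg ⁅x, ⁅y, b⁆⁆]
  rw [e]
  have n1 := norm_add_le (φ (ψ b - (b + s • ⁅y, b⁆)) + (φ b - (b + s • ⁅x, b⁆))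
      + s • (φ ⁅y, b⁆ - (⁅y, b⁆ + s • ⁅x, ⁅y, b⁆⁆))) ((s * s) • ⁅x, ⁅y, b⁆⁆)
  have n2 := norm_add_le (φ (ψ b - (b + s • ⁅y, b⁆)) + (φ b - (b + s • ⁅x, b⁆)))
      (s • (φ ⁅y, b⁆ - (⁅y, b⁆ + s • ⁅x, ⁅y, b⁆⁆)))
  have n3 := norm_add_le (φ (ψ b - (b + s • ⁅y, b⁆))) (φ b - (b + s • ⁅x, b⁆))
  linarith

theorem IsTangent.neg {x : A} (hx : IsTangent H x) : IsTangent H (-x) := by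
  classical
  intro F ε hε
  filter_upwards [hx (F ∪ F.image fun b => ⁅x, b⁆) (ε / 4) (by positivity),
    self_mem_nhdsWithin, Ioo_mem_nhdsGT (show (0 : ℝ) < 1 by norm_num),
    (Filter.eventually_all_finset F).2 fun b _ => Ioo_mem_nhdsGT
      (show (0 : ℝ) < ε / (4 * (‖⁅x, ⁅x, b⁆⁆‖ + 1)) by positivity)]
    with s ⟨φ, hφ, h1⟩ hs0 hs1 hs
  have hs0 : 0 < s := hs0
  refine ⟨φ⁻¹, H.inv_mem hφ, fun b hb => ?_⟩
  have a1 := h1 b (Finset.mem_union_left _ hb)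
  have a3 := h1 ⁅x, b⁆ (Finset.mem_union_right _ (Finset.mem_image_of_mem _ hb))
  have e : φ (φ⁻¹ b - (b + s • ⁅-x, b⁆)) = -(φ b - (b + s • ⁅x, b⁆))
      + s • (φ ⁅x, b⁆ - (⁅x, b⁆ + s • ⁅x, ⁅x, b⁆⁆)) + (s * s) • ⁅x, ⁅x, b⁆⁆ := by
    rw [map_sub, map_add, aut_real_smul, aut_apply_inv_self, neg_lie, map_neg, smul_sub, smul_add,
      mul_smul, smul_neg]
    abel
  have b1 : ‖-(φ b - (b + s • ⁅x, b⁆))‖ ≤ ε / 4 * s := by rwa [norm_neg]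
  have b2 : ‖s • (φ ⁅x, b⁆ - (⁅x, b⁆ + s • ⁅x, ⁅x, b⁆⁆))‖ ≤ ε / 4 * s := by
    rw [norm_smul, Real.norm_of_nonneg hs0.le]
    have : s * (ε / 4 * s) ≤ ε / 4 * s := by
      have := mul_le_mul_of_nonneg_right hs1.2.le (show 0 ≤ ε / 4 * s by positivity)
      linarith
    exact (mul_le_mul_of_nonneg_left a3 hs0.le).trans this
  have b3 : ‖(s * s) • ⁅x, ⁅x, b⁆⁆‖ ≤ ε / 4 * s := by
    rw [norm_smul, Real.norm_of_nonneg (by positivity), mul_assoc, mul_comm (ε / 4)]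
    refine mul_le_mul_of_nonneg_left ?_ hs0.le
    have := (hs b hb).2
    rw [lt_div_iff₀ (by positivity)] at this
    nlinarith [norm_nonneg ⁅x, ⁅x, b⁆⁆]
  rw [← aut_norm φ, e]
  have n2 := norm_add_le (-(φ b - (b + s • ⁅x, b⁆))
      + s • (φ ⁅x, b⁆ - (⁅x, b⁆ + s • ⁅x, ⁅x, b⁆⁆))) ((s * s) • ⁅x, ⁅x, b⁆⁆)
  have n3 := norm_add_le (-(φ b - (b + s • ⁅x, b⁆)))
      (s • (φ ⁅x, b⁆ - (⁅x, b⁆ + s • ⁅x, ⁅x, b⁆⁆)))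
  have : 0 ≤ ε / 4 * s := by positivity
  linarith

theorem IsTangent.smul {x : A} (hx : IsTangent H x) (r : ℝ) : IsTangent H (r • x) := by
  have hpos : ∀ r : ℝ, 0 < r → IsTangent H (r • x) := by
    intro r hr F ε hε
    have ht : Tendsto (fun s : ℝ => r * s) (𝓝[>] 0) (𝓝[>] 0) := by
      refine tendsto_nhdsWithin_iff.2 ⟨?_, ?_⟩
      · have hc : Continuous fun s : ℝ => r * s := by fun_prop
        have := hc.tendsto 0
        rw [mul_zero] at this
        exact this.mono_left nhdsWithin_le_nhds
      · filter_upwards [self_mem_nhdsWithin] with s hs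
        exact mul_pos hr hs
    filter_upwards [ht.eventually (hx F (ε / r) (by positivity))] with s ⟨φ, hφ, hs⟩
    refine ⟨φ, hφ, fun b hb => ?_⟩
    have := hs b hb
    have e : ⁅r • x, b⁆ = r • ⁅x, b⁆ := smul_lie r x b
    rw [e, smul_smul, mul_comm s r]
    refine this.trans (le_of_eq ?_)
    field_simp
  rcases lt_trichotomy r 0 with h | h | h
  · have := (hpos (-r) (by linarith)).neg
    rwa [neg_smul, neg_neg] at this
  · rw [h, zero_smul]
    exact IsTangent.zero H
  · exact hpos r h

theorem IsTangent.conj {x : A} (hx : IsTangent H x) {ψ : A ≃⋆ₐ[ℂ] A}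
    (hψ : ∀ φ ∈ H, ψ * φ * ψ⁻¹ ∈ H) : IsTangent H (ψ x) := by
  classical
  intro F ε hε
  filter_upwards [hx (F.image fun b => ψ⁻¹ b) ε hε] with s ⟨φ, hφ, hs⟩
  refine ⟨ψ * φ * ψ⁻¹, hψ φ hφ, fun b hb => ?_⟩
  have := hs _ (Finset.mem_image_of_mem (fun b => ψ⁻¹ b) hb)
  rw [← aut_norm ψ, map_sub, map_add, aut_real_smul, aut_lie, aut_apply_inv_self] at this
  exact this

/-- If `H` is normalized by the one-parameter group of `h` and `φ ∈ H`, then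
`i h - φ (i h)` is tangent to `H`, being the derivative of the group commutator of `Ad(exp(i s h))`
and `φ`. -/
theorem isTangent_sub_apply {φ : A ≃⋆ₐ[ℂ] A} (hφ : φ ∈ H) (h : selfAdjoint A)
    (hN : ∀ s, ∀ φ ∈ H, flow h s * φ * (flow h s)⁻¹ ∈ H) :
    IsTangent H (Complex.I • (h : A) - φ (Complex.I • (h : A))) := by
  classical
  set x : A := Complex.I • (h : A) with hx
  have hxn : Complex.I • ((-h : selfAdjoint A) : A) = -x := by
    rw [NegMemClass.coe_neg, smul_neg]
  intro F ε hε
  filter_upwards [eventually_flow h (F ∪ F.image fun b => ⁅φ x, b⁆) (show 0 < ε / 4 by positivity),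
    eventually_flow (-h) (F.image fun b => φ⁻¹ b) (show 0 < ε / 4 by positivity),
    self_mem_nhdsWithin, Ioo_mem_nhdsGT (show (0 : ℝ) < 1 by norm_num),
    (Filter.eventually_all_finset F).2 fun b _ => Ioo_mem_nhdsGT
      (show (0 : ℝ) < ε / (4 * (‖⁅x, ⁅φ x, b⁆⁆‖ + 1)) by positivity)]
    with s h1 h2 hs0 hs1 hs
  have hs0 : 0 < s := hs0
  refine ⟨flow h s * φ * (flow h s)⁻¹ * φ⁻¹, H.mul_mem (hN s φ hφ) (H.inv_mem hφ), fun b hb => ?_⟩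
  have hinv : (flow h s)⁻¹ = flow (-h) s := by
    rw [flow_neg]
    refine inv_eq_of_mul_eq_one_right ?_
    rw [← flow_add, add_neg_cancel, flow_zero]
  have a1 := h1 b (Finset.mem_union_left _ hb)
  have a2 := h1 ⁅φ x, b⁆ (Finset.mem_union_right _ (Finset.mem_image_of_mem _ hb))
  have a3 := h2 _ (Finset.mem_image_of_mem (fun b => φ⁻¹ b) hb)
  rw [hxn] at a3
  set Φ := flow h s with hΦ
  set Ψ := flow (-h) s with hΨ
  have e : (Φ * φ * Φ⁻¹ * φ⁻¹) b - (b + s • ⁅x - φ x, b⁆)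
      = Φ (φ (Ψ (φ⁻¹ b) - (φ⁻¹ b + s • ⁅-x, φ⁻¹ b⁆))) + (Φ b - (b + s • ⁅x, b⁆))
        - s • (Φ ⁅φ x, b⁆ - (⁅φ x, b⁆ + s • ⁅x, ⁅φ x, b⁆⁆)) - (s * s) • ⁅x, ⁅φ x, b⁆⁆ := by
    rw [hinv, aut_mul_apply, aut_mul_apply, aut_mul_apply, map_sub φ, map_add φ, aut_real_smul φ,
      aut_lie φ, aut_apply_inv_self, map_neg φ, map_sub Φ, map_add Φ, aut_real_smul Φ, neg_lie,
      map_neg Φ, smul_neg, sub_lie, smul_sub, smul_sub, smul_add, mul_smul]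
    abel
  have b1 : ‖Φ (φ (Ψ (φ⁻¹ b) - (φ⁻¹ b + s • ⁅-x, φ⁻¹ b⁆)))‖ ≤ ε / 4 * s := by
    rwa [aut_norm, aut_norm]
  have b2 : ‖s • (Φ ⁅φ x, b⁆ - (⁅φ x, b⁆ + s • ⁅x, ⁅φ x, b⁆⁆))‖ ≤ ε / 4 * s := by
    rw [norm_smul, Real.norm_of_nonneg hs0.le]
    have : s * (ε / 4 * s) ≤ ε / 4 * s := by
      have := mul_le_mul_of_nonneg_right hs1.2.le (show 0 ≤ ε / 4 * s by positivity)
      linarith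
    exact (mul_le_mul_of_nonneg_left a2 hs0.le).trans this
  have b3 : ‖(s * s) • ⁅x, ⁅φ x, b⁆⁆‖ ≤ ε / 4 * s := by
    rw [norm_smul, Real.norm_of_nonneg (by positivity), mul_assoc, mul_comm (ε / 4)]
    refine mul_le_mul_of_nonneg_left ?_ hs0.le
    have := (hs b hb).2
    rw [lt_div_iff₀ (by positivity)] at this
    nlinarith [norm_nonneg ⁅x, ⁅φ x, b⁆⁆]
  rw [e]
  have n1 := norm_sub_le (Φ (φ (Ψ (φ⁻¹ b) - (φ⁻¹ b + s • ⁅-x, φ⁻¹ b⁆))) + (Φ b - (b + s • ⁅x, b⁆))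
      - s • (Φ ⁅φ x, b⁆ - (⁅φ x, b⁆ + s • ⁅x, ⁅φ x, b⁆⁆))) ((s * s) • ⁅x, ⁅φ x, b⁆⁆)
  have n2 := norm_sub_le (Φ (φ (Ψ (φ⁻¹ b) - (φ⁻¹ b + s • ⁅-x, φ⁻¹ b⁆)))
      + (Φ b - (b + s • ⁅x, b⁆))) (s • (Φ ⁅φ x, b⁆ - (⁅φ x, b⁆ + s • ⁅x, ⁅φ x, b⁆⁆)))
  have n3 := norm_add_le (Φ (φ (Ψ (φ⁻¹ b) - (φ⁻¹ b + s • ⁅-x, φ⁻¹ b⁆)))) (Φ b - (b + s • ⁅x, b⁆))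
  linarith

/-- Tangent elements are stable under `[i h, ·]` for selfadjoint `h` whose one-parameter group
normalizes `H`. -/
theorem IsTangent.lie {x : A} (hx : IsTangent H x) (h : selfAdjoint A)
    (hN : ∀ s, ∀ φ ∈ H, flow h s * φ * (flow h s)⁻¹ ∈ H) :
    IsTangent H ⁅Complex.I • (h : A), x⁆ := by
  have ht := (hasDerivAt_iff_tendsto_slope_zero.1 (hasDerivAt_flow h x)).mono_left
    (nhdsGT_le_nhdsNE 0)
  refine (isClosed_setOf_isTangent H).mem_of_tendsto ht (Eventually.of_forall fun t => ?_)
  rw [zero_add, flow_zero, aut_one_apply, sub_eq_add_neg]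
  exact ((hx.conj (hN t)).add hx.neg).smul _

/-- The one-parameter group of a tangent element of a closed group stays in the group. -/
theorem Ad_expUnitary_mem_of_isTangent (hcl : IsClosed (H : Set (A ≃⋆ₐ[ℂ] A))) (h : selfAdjoint A)
    (hx : IsTangent H (Complex.I • (h : A))) : Ad (selfAdjoint.expUnitary h) ∈ H := by
  classical
  have hflow : flow h 1 = Ad (selfAdjoint.expUnitary h) := by rw [flow, one_smul]
  rw [← hflow]
  refine mem_of_forall_approx hcl _ fun F ε hε => ?_
  -- `D t` measures how far the inverse of `flow h t` is from `H` on `F`; it grows at arbitrarily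
  -- small rate
  let D : ℝ → ℝ := fun t => ⨅ φ : H, ∑ b ∈ F, ‖(φ : A ≃⋆ₐ[ℂ] A) (flow h t b) - b‖
  have hbdd : ∀ t, BddBelow (Set.range fun φ : H =>
      ∑ b ∈ F, ‖(φ : A ≃⋆ₐ[ℂ] A) (flow h t b) - b‖) := fun t =>
    ⟨0, by rintro _ ⟨φ, rfl⟩; positivity⟩
  have hlip : ∀ t t', D t ≤ D t' + ∑ b ∈ F, ‖flow h t b - flow h t' b‖ := by
    intro t t'
    rw [← sub_le_iff_le_add]
    refine le_ciInf fun φ => ?_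
    rw [sub_le_iff_le_add]
    refine (ciInf_le (hbdd t) φ).trans ?_
    rw [← Finset.sum_add_distrib]
    refine Finset.sum_le_sum fun b _ => ?_
    have e : φ.1 (flow h t b) - b = (φ.1 (flow h t' b) - b) + φ.1 (flow h t b - flow h t' b) := by
      rw [map_sub]
      abel
    rw [e]
    exact (norm_add_le _ _).trans_eq (by rw [aut_norm])
  have hDc : Continuous D := by
    refine continuous_iff_continuousAt.2 fun t => ?_
    have hS : Tendsto (fun t' => ∑ b ∈ F, ‖flow h t' b - flow h t b‖) (𝓝 t) (𝓝 0) := by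
      have hc : Continuous fun t' => ∑ b ∈ F, ‖flow h t' b - flow h t b‖ :=
        continuous_finsetSum _ fun b _ => ((continuous_flow h b).sub continuous_const).norm
      have := hc.tendsto t
      simpa using this
    rw [ContinuousAt, tendsto_iff_dist_tendsto_zero]
    refine squeeze_zero (fun _ => dist_nonneg) (fun t' => ?_) hS
    rw [Real.dist_eq, abs_le]
    have h1 := hlip t t'
    have h2 := hlip t' t
    have e : ∑ b ∈ F, ‖flow h t b - flow h t' b‖ = ∑ b ∈ F, ‖flow h t' b - flow h t b‖ :=
      Finset.sum_congr rfl fun b _ => norm_sub_rev _ _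
    constructor <;> linarith
  have hstep : ∀ t, ∀ᶠ s : ℝ in 𝓝[>] 0, D (t + s) ≤ D t + ε / 2 * s := by
    intro t
    set η := ε / (4 * (F.card + 1)) with hη
    have hη0 : 0 < η := by positivity
    filter_upwards [hx (F.image (flow h t)) η hη0, eventually_flow h (F.image (flow h t)) hη0,
      self_mem_nhdsWithin] with s ⟨ψ, hψ, h1⟩ h2 hs0
    have hs0 : 0 < s := hs0
    rw [← sub_le_iff_le_add]
    refine le_ciInf fun φ => ?_
    rw [sub_le_iff_le_add]
    refine (ciInf_le (hbdd _) (φ * ⟨ψ, hψ⟩⁻¹)).trans ?_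
    have hb : ∀ b ∈ F, ‖((φ * ⟨ψ, hψ⟩⁻¹ : H) : A ≃⋆ₐ[ℂ] A) (flow h (t + s) b) - b‖
        ≤ ‖φ.1 (flow h t b) - b‖ + 2 * (η * s) := by
      intro b hb
      set c := flow h t b with hc
      have e1 : flow h (t + s) b = flow h s c := by rw [add_comm, flow_add, aut_mul_apply]
      have e2 : ((φ * ⟨ψ, hψ⟩⁻¹ : H) : A ≃⋆ₐ[ℂ] A) (flow h (t + s) b) - b
          = (φ.1 c - b) + φ.1 (ψ⁻¹ ((flow h s c - (c + s • ⁅Complex.I • (h : A), c⁆))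
            - (ψ c - (c + s • ⁅Complex.I • (h : A), c⁆)))) := by
        rw [e1, sub_sub_sub_cancel_right, map_sub ψ⁻¹, aut_inv_apply_self, map_sub φ.1]
        change φ.1 (ψ⁻¹ (flow h s c)) - b = _
        abel
      rw [e2]
      refine (norm_add_le _ _).trans (add_le_add le_rfl ?_)
      rw [aut_norm, aut_norm]
      have m := Finset.mem_image_of_mem (flow h t) hb
      exact (norm_sub_le _ _).trans (by linarith [h1 c m, h2 c m])
    refine (Finset.sum_le_sum hb).trans ?_
    rw [Finset.sum_add_distrib, Finset.sum_const, nsmul_eq_mul]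
    refine add_le_add le_rfl ?_
    have : (F.card : ℝ) * η ≤ ε / 4 := by
      rw [hη, mul_div_assoc', div_le_div_iff₀ (by positivity) (by norm_num)]
      nlinarith
    nlinarith
  have hD0 : D 0 ≤ 0 := by
    refine (ciInf_le (hbdd 0) 1).trans (le_of_eq ?_)
    refine Finset.sum_eq_zero fun b _ => ?_
    rw [flow_zero]
    exact norm_eq_zero.2 (sub_self b)
  have hD1 : D 1 ≤ ε / 2 * 1 := by
    refine image_le_of_liminf_slope_right_le_deriv_boundary (a := 0) (b := 1)
      (B := fun t => ε / 2 * t) (B' := fun _ => ε / 2) hDc.continuousOn (by simpa using hD0)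
      (by fun_prop) (fun t _ => ?_) (fun t _ r hr => ?_) (by simp)
    · simpa using ((hasDerivAt_id t).const_mul (ε / 2)).hasDerivWithinAt
    · refine Eventually.frequently ?_
      have ht : Tendsto (fun z : ℝ => z - t) (𝓝[>] t) (𝓝[>] 0) := by
        refine tendsto_nhdsWithin_iff.2 ⟨?_, ?_⟩
        · have hc : Continuous fun z : ℝ => z - t := by fun_prop
          have := hc.tendsto t
          rw [sub_self] at this
          exact this.mono_left nhdsWithin_le_nhds
        · filter_upwards [self_mem_nhdsWithin] with z hz
          exact sub_pos.2 (Set.mem_Ioi.1 hz)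
      filter_upwards [ht.eventually (hstep t), self_mem_nhdsWithin] with z hz hzt
      have hzt : 0 < z - t := sub_pos.2 hzt
      rw [add_sub_cancel] at hz
      rw [slope_def_field]
      refine lt_of_le_of_lt ?_ hr
      rw [div_le_iff₀ hzt]
      linarith
  obtain ⟨φ, hφ⟩ := exists_lt_of_ciInf_lt (lt_of_le_of_lt hD1 (show ε / 2 * 1 < ε by linarith))
  refine ⟨φ.1⁻¹, H.inv_mem φ.2, fun b hb => ?_⟩
  rw [← aut_norm φ.1, map_sub, aut_apply_inv_self, norm_sub_rev]
  refine lt_of_le_of_lt ?_ hφ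
  exact Finset.single_le_sum (f := fun b => ‖φ.1 (flow h 1 b) - b‖)
    (fun _ _ => norm_nonneg _) hb

end Tangent

/-! ### Lie ideals and two-sided ideals -/

section LieIdeals

variable {A : Type*} [CStarAlgebra A]

theorem lie_mem_commutatorSpan {S T : Set A} {x y : A} (hx : x ∈ S) (hy : y ∈ T) :
    ⁅x, y⁆ ∈ commutatorSpan S T :=
  Submodule.subset_span ⟨x, hx, y, hy, rfl⟩

theorem commutatorSpan_subset {S T : Set A} (J : ClosedIdeal A)
    (h : ∀ x ∈ S, ∀ y ∈ T, ⁅x, y⁆ ∈ J.toIdeal) :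
    (commutatorSpan S T : Set A) ⊆ J.toIdeal := by
  intro z hz
  induction hz using Submodule.span_induction with
  | mem z hz =>
    obtain ⟨x, hx, y, hy, rfl⟩ := hz
    exact h x hx y hy
  | zero => exact J.toIdeal.zero_mem
  | add x y _ _ hx hy => exact J.toIdeal.add_mem hx hy
  | smul c x _ hx => exact J.smul_mem c hx

theorem ClosedIdeal.lie_mem (J : ClosedIdeal A) {x : A} (hx : x ∈ J.toIdeal) (a : A) :
    ⁅x, a⁆ ∈ J.toIdeal :=
  J.toIdeal.sub_mem (J.toIdeal.mul_mem_right _ hx) (J.toIdeal.mul_mem_left _ hx)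

/-- Herstein's theorem in closed form: if `L` is a closed Lie ideal and `K` is the closed
two-sided ideal generated by `[L, L]`, then `[K, A] ⊆ L`. -/
theorem lie_mem_of_mem_idealGeneratedBy {L : Submodule ℂ A} (hcl : IsClosed (L : Set A))
    (hL : ∀ x ∈ L, ∀ a, ⁅x, a⁆ ∈ L) {k : A}
    (hk : k ∈ (idealGeneratedBy (commutatorSpan (L : Set A) (L : Set A) : Set A)).toIdeal) (a : A) :
    ⁅k, a⁆ ∈ L := by
  -- the largest two-sided ideal contained in `{t | [t, A] ⊆ L}`
  let N : ClosedIdeal A :=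
    { toIdeal :=
        { carrier := {k | ∀ b c a, ⁅b * k * c, a⁆ ∈ L}
          add_mem' := fun {x y} hx hy b c a => by
            rw [mul_add, add_mul, add_lie]
            exact L.add_mem (hx b c a) (hy b c a)
          zero_mem' := fun b c a => by
            rw [mul_zero, zero_mul, zero_lie]
            exact L.zero_mem
          smul_mem' := fun r x hx b c a => by
            rw [smul_eq_mul, ← mul_assoc b]
            exact hx (b * r) c a }
      isTwoSided := ⟨fun {x} r hx b c a => by
        rw [mul_assoc, mul_assoc, ← mul_assoc]
        exact hx b (r * c) a⟩
      isClosed := by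
        have : {k : A | ∀ b c a, ⁅b * k * c, a⁆ ∈ L}
            = ⋂ (b : A) (c : A) (a : A), (fun k => ⁅b * k * c, a⁆) ⁻¹' (L : Set A) := by
          ext
          simp
        change IsClosed {k : A | ∀ b c a, ⁅b * k * c, a⁆ ∈ L}
        rw [this]
        refine isClosed_iInter fun b => isClosed_iInter fun c => isClosed_iInter fun a =>
          hcl.preimage ?_
        simp only [Ring.lie_def]
        fun_prop }
  have hmul : ∀ s t : A, (∀ a, ⁅s, a⁆ ∈ L) → (∀ a, ⁅t, a⁆ ∈ L) → ∀ a, ⁅s * t, a⁆ ∈ L := by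
    intro s t hs ht a
    have e : ⁅s * t, a⁆ = ⁅s, t * a⁆ + ⁅t, a * s⁆ := by
      simp only [Ring.lie_def]
      noncomm_ring
    rw [e]
    exact L.add_mem (hs _) (ht _)
  have hN : (idealGeneratedBy (commutatorSpan (L : Set A) (L : Set A) : Set A)).toIdeal
      ≤ N.toIdeal := by
    refine idealGeneratedBy_le (commutatorSpan_subset N fun x hx y hy => ?_)
    have h1 : ∀ c a, ⁅⁅x, y⁆ * c, a⁆ ∈ L := by
      intro c a
      have e : ⁅x, y⁆ * c = ⁅x, y * c⁆ - y * ⁅x, c⁆ := by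
        simp only [Ring.lie_def]
        noncomm_ring
      rw [e, sub_lie]
      exact L.sub_mem (hL _ (hL x hx _) _) (hmul _ _ (hL y hy) (hL _ (hL x hx _)) a)
    intro b c a
    have e : b * ⁅x, y⁆ * c = ⁅x, y⁆ * (c * b) - ⁅⁅x, y⁆ * c, b⁆ := by
      rw [Ring.lie_def (_ * c)]
      noncomm_ring
    rw [e, sub_lie]
    exact L.sub_mem (h1 _ _) (hL _ (h1 _ _) _)
  simpa using hN hk 1 1 a

/-- The derivation `δ = [x, ·]` with `δ² = 0` satisfies `δ(b) δ(c) = 0`, and `δ(b)⋆ = -δ(b⋆)`. -/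
theorem lie_eq_zero_of_lie_lie_eq_zero {x : A} (hx : IsSelfAdjoint x)
    (h : ∀ a : A, ⁅x, ⁅x, a⁆⁆ = 0) (a : A) : ⁅x, a⁆ = 0 := by
  have hsq : ∀ b c : A, ⁅x, b⁆ * ⁅x, c⁆ = 0 := by
    intro b c
    have e : ⁅x, ⁅x, b * c⁆⁆ = ⁅x, ⁅x, b⁆⁆ * c + (2 : ℕ) • (⁅x, b⁆ * ⁅x, c⁆) + b * ⁅x, ⁅x, c⁆⁆ := by
      simp only [Ring.lie_def]
      noncomm_ring
    rw [h, h, h, zero_mul, mul_zero, zero_add, add_zero, ← Nat.cast_smul_eq_nsmul ℂ] at e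
    exact (smul_eq_zero.1 e.symm).resolve_left (by norm_num)
  have hs : star ⁅x, a⁆ = -⁅x, star a⁆ := by
    rw [Ring.lie_def, Ring.lie_def, star_sub, star_mul, star_mul, hx.star_eq, neg_sub]
  rw [← CStarRing.mul_star_self_eq_zero_iff, hs, mul_neg, hsq, neg_zero]

/-- A `⋆`-closed Lie ideal that is commutative modulo `K` is central modulo `K`. -/
theorem lie_mem_of_commutator_mem (K : ClosedIdeal A) {L : Submodule ℂ A}
    (hL : ∀ x ∈ L, ∀ a, ⁅x, a⁆ ∈ L) (hstar : ∀ x ∈ L, star x ∈ L)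
    (hK : ∀ x ∈ L, ∀ y ∈ L, ⁅x, y⁆ ∈ K.toIdeal) {x : A} (hx : x ∈ L) (a : A) :
    ⁅x, a⁆ ∈ K.toIdeal := by
  have hproj : ∀ y b : A, K.proj ⁅y, b⁆ = ⁅K.proj y, K.proj b⁆ := fun y b => by
    rw [Ring.lie_def, Ring.lie_def, map_sub, map_mul, map_mul]
  have hsa : ∀ y ∈ L, IsSelfAdjoint y → ⁅y, a⁆ ∈ K.toIdeal := by
    intro y hy hys
    rw [← K.proj_eq_zero, hproj]
    refine lie_eq_zero_of_lie_lie_eq_zero (x := K.proj y) ?_ (fun b => ?_) _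
    · rw [IsSelfAdjoint, ← K.proj_star, hys.star_eq]
    · obtain ⟨b, rfl⟩ := K.proj_surjective b
      rw [← hproj, ← hproj, K.proj_eq_zero]
      exact hK y hy _ (hL y hy b)
  have h1 := hsa _ (L.add_mem hx (hstar x hx)) (IsSelfAdjoint.add_star_self x)
  have h2 := hsa _ (L.smul_mem Complex.I (L.sub_mem hx (hstar x hx))) (by
    rw [IsSelfAdjoint, star_smul, star_sub, star_star, Complex.star_def, Complex.conj_I, neg_smul,
      ← smul_neg, neg_sub])
  have e : ⁅x, a⁆ = (1 / 2 : ℂ) • (⁅x + star x, a⁆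
      - Complex.I • ⁅Complex.I • (x - star x), a⁆) := by
    have : ⁅Complex.I • (x - star x), a⁆ = Complex.I • ⁅x - star x, a⁆ := smul_lie _ _ _
    rw [this, smul_smul, Complex.I_mul_I, neg_smul, one_smul, sub_neg_eq_add, ← add_lie,
      add_add_sub_cancel, ← two_smul ℂ x]
    have : ⁅(2 : ℂ) • x, a⁆ = (2 : ℂ) • ⁅x, a⁆ := smul_lie _ _ _
    rw [this, smul_smul]
    norm_num
  rw [e]
  exact K.smul_mem _ (K.toIdeal.sub_mem h1 (K.smul_mem _ h2))

end LieIdeals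

/-! ### Automorphisms that are central modulo an ideal -/

section Central

variable {A : Type*} [CStarAlgebra A]

theorem apply_eq_self_of_central {φ : A ≃⋆ₐ[ℂ] A} (hφ : φ ∈ V A) {z : A} (hz : ∀ a : A, ⁅z, a⁆ = 0) :
    φ z = z := by
  have hcl : IsClosed {ψ : A ≃⋆ₐ[ℂ] A | ψ z = z} :=
    isClosed_eq (continuous_aut_apply z) continuous_const
  refine closure_minimal ?_ hcl hφ
  rintro _ ⟨u, -, rfl⟩
  have h : z * (u : A) = u * z := by
    have := hz u
    rwa [Ring.lie_def, sub_eq_zero] at this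
  change Ad u z = z
  rw [Ad_apply, ← h, mul_assoc, Unitary.mul_star_self_of_mem u.2, mul_one]

/-- An element of `V_A` that moves every element by a central element is trivial. -/
theorem apply_eq_self_of_sub_central {φ : A ≃⋆ₐ[ℂ] A} (hφ : φ ∈ V A)
    (hc : ∀ x a : A, ⁅φ x - x, a⁆ = 0) (x : A) : φ x = x := by
  set z := φ x - x with hz
  have hzc : ∀ a, z * a = a * z := fun a => by
    have := hc x a
    rwa [Ring.lie_def, sub_eq_zero] at this
  have hx : φ x = x + z := by rw [hz, add_sub_cancel]
  -- `φ` fixes all commutators, hence also `x [x, y] = [x, x y]`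
  have hlie : ∀ a b : A, φ ⁅a, b⁆ = ⁅a, b⁆ := by
    intro a b
    have ha : φ a = a + (φ a - a) := by abel
    have hb : φ b = b + (φ b - b) := by abel
    rw [aut_lie, ha, add_lie, hc, add_zero, hb, lie_add, ← lie_skew a (φ b - b), hc, neg_zero,
      add_zero]
  have h1 : ∀ y, z * ⁅x, y⁆ = 0 := by
    intro y
    have e : ⁅x, x * y⁆ = x * ⁅x, y⁆ := by
      simp only [Ring.lie_def]
      noncomm_ring
    have := hlie x (x * y)
    rw [e, map_mul, hlie, hx, add_mul] at this
    exact add_eq_left.1 this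
  have h2 : φ (z * x) = z * x := by
    refine apply_eq_self_of_central hφ fun y => ?_
    rw [← h1 y]
    simp only [Ring.lie_def]
    rw [← mul_assoc, ← hzc y]
    noncomm_ring
  have hφz : φ z = z := apply_eq_self_of_central hφ (hc x)
  have h3 : z * z = 0 := by
    rw [map_mul, hφz, hx, mul_add] at h2
    exact add_eq_left.1 h2
  -- a central element of square zero vanishes
  have h4 : star z * z = 0 := by
    rw [← CStarRing.star_mul_self_eq_zero_iff, star_mul, star_star, ← mul_assoc,
      mul_assoc (star z) z, hzc (star z), ← mul_assoc, mul_assoc _ z z, h3, mul_zero]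
  have h5 := (CStarRing.star_mul_self_eq_zero_iff z).1 h4
  rw [hx, h5, add_zero]

/-- `apply_eq_self_of_sub_central` for the automorphism induced on `A / K`. -/
theorem ClosedIdeal.sub_mem_of_lie_mem (K : ClosedIdeal A) {φ : A ≃⋆ₐ[ℂ] A} (hφ : φ ∈ CStarNormal.V A)
    (hc : ∀ x a, ⁅φ x - x, a⁆ ∈ K.toIdeal) (x : A) : φ x - x ∈ K.toIdeal := by
  rw [← K.proj_eq_proj]
  refine apply_eq_self_of_sub_central (K.inducedAut_mem ⟨φ, hφ⟩) (fun y b => ?_) (K.proj x)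
  obtain ⟨y, rfl⟩ := K.proj_surjective y
  obtain ⟨b, rfl⟩ := K.proj_surjective b
  have := K.proj_eq_zero.2 (hc y b)
  rwa [Ring.lie_def, map_sub, map_mul, map_mul, map_sub] at this

end Central

/-! ### The tangent space of a normal subgroup -/

section TangentSpace

variable {A : Type*} [CStarAlgebra A] {H : Subgroup (A ≃⋆ₐ[ℂ] A)}

/-- The complexification of the real space of skew-adjoint elements tangent to `H`: the elements
`x` such that `x - x⋆` and `i (x + x⋆)` are tangent to `H`. -/
def tangentSpace (H : Subgroup (A ≃⋆ₐ[ℂ] A)) : Submodule ℂ A where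
  carrier := {x | IsTangent H (x - star x) ∧ IsTangent H (Complex.I • (x + star x))}
  add_mem' {x y} hx hy := by
    constructor
    · rw [star_add, add_sub_add_comm]
      exact hx.1.add hy.1
    · rw [star_add, add_add_add_comm, smul_add]
      exact hx.2.add hy.2
  zero_mem' := by
    constructor
    · simpa using IsTangent.zero H
    · simpa using IsTangent.zero H
  smul_mem' z x hx := by
    have e : z • x = z.re • x + z.im • (Complex.I • x) := by
      rw [← Complex.coe_smul, ← Complex.coe_smul, smul_smul, ← add_smul, Complex.re_add_im]
    constructor
    · have : z • x - star (z • x) = z.re • (x - star x) + z.im • (Complex.I • (x + star x)) := by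
        rw [e, star_add, star_smul, star_smul, star_smul, star_trivial z.re, star_trivial z.im,
          Complex.star_def, Complex.conj_I]
        module
      rw [this]
      exact (hx.1.smul _).add (hx.2.smul _)
    · have : Complex.I • (z • x + star (z • x))
          = z.re • (Complex.I • (x + star x)) + (-z.im) • (x - star x) := by
        have h1 : ∀ y : A, Complex.I • (Complex.I • y) = -y := fun y => by
          rw [smul_smul, Complex.I_mul_I, neg_one_smul]
        rw [e, star_add, star_smul, star_smul, star_smul, star_trivial z.re, star_trivial z.im,
          Complex.star_def, Complex.conj_I]
        simp only [smul_add, smul_comm Complex.I z.re, smul_comm Complex.I z.im, neg_smul, smul_neg,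
          h1, smul_sub]
        abel
      rw [this]
      exact (hx.2.smul _).add (hx.1.smul _)

theorem isClosed_tangentSpace (H : Subgroup (A ≃⋆ₐ[ℂ] A)) :
    IsClosed (tangentSpace H : Set A) := by
  have h := isClosed_setOf_isTangent H
  exact (h.preimage (f := fun x : A => x - star x) (by fun_prop)).inter
    (h.preimage (f := fun x : A => Complex.I • (x + star x)) (by fun_prop))

theorem star_mem_tangentSpace {x : A} (hx : x ∈ tangentSpace H) : star x ∈ tangentSpace H := by
  constructor
  · rw [star_star, ← neg_sub]
    exact hx.1.neg
  · rw [star_star, add_comm]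
    exact hx.2

theorem IsTangent.mem_tangentSpace {x : A} (hx : IsTangent H x) (hs : star x = -x) :
    x ∈ tangentSpace H := by
  constructor
  · rw [hs, sub_neg_eq_add]
    exact hx.add hx
  · rw [hs, add_neg_cancel, smul_zero]
    exact IsTangent.zero H

/-- The tangent space of a group normalized by all one-parameter groups is a Lie ideal. -/
theorem lie_mem_tangentSpace
    (hN : ∀ h : selfAdjoint A, ∀ s, ∀ φ ∈ H, flow h s * φ * (flow h s)⁻¹ ∈ H) {x : A}
    (hx : x ∈ tangentSpace H) (a : A) : ⁅x, a⁆ ∈ tangentSpace H := by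
  have key : ∀ y : A, IsTangent H y → star y = -y → ⁅y, a⁆ ∈ tangentSpace H := by
    intro y hy hs
    have hsa : ∀ h : selfAdjoint A, ⁅y, (h : A)⁆ ∈ tangentSpace H := by
      intro h
      have h1 := (hy.lie h (hN h)).mem_tangentSpace (by
        simp only [Ring.lie_def, star_sub, star_mul, star_smul, hs, h.2.star_eq, Complex.star_def,
          Complex.conj_I, neg_smul, neg_mul, mul_neg, neg_neg, neg_sub])
      have e : ⁅y, (h : A)⁆ = Complex.I • ⁅Complex.I • (h : A), y⁆ := by
        have : ⁅Complex.I • (h : A), y⁆ = Complex.I • ⁅(h : A), y⁆ := smul_lie _ _ _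
        rw [this, smul_smul, Complex.I_mul_I, neg_one_smul, lie_skew]
      rw [e]
      exact (tangentSpace H).smul_mem _ h1
    rw [← realPart_add_I_smul_imaginaryPart a, lie_add]
    have e : ⁅y, Complex.I • (imaginaryPart a : A)⁆ = Complex.I • ⁅y, (imaginaryPart a : A)⁆ :=
      lie_smul _ _ _
    rw [e]
    exact (tangentSpace H).add_mem (hsa _) ((tangentSpace H).smul_mem _ (hsa _))
  have h1 := key _ hx.1 (by rw [star_sub, star_star, neg_sub])
  have h2 := key _ hx.2 (by
    rw [star_smul, star_add, star_star, Complex.star_def, Complex.conj_I, neg_smul,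
      add_comm (star x)])
  have e : ⁅x, a⁆ = (1 / 2 : ℂ) • (⁅x - star x, a⁆
      - Complex.I • ⁅Complex.I • (x + star x), a⁆) := by
    have : ⁅Complex.I • (x + star x), a⁆ = Complex.I • ⁅x + star x, a⁆ := smul_lie _ _ _
    rw [this, smul_smul, Complex.I_mul_I, neg_smul, one_smul, sub_neg_eq_add, ← add_lie,
      sub_add_add_cancel, ← two_smul ℂ x]
    have : ⁅(2 : ℂ) • x, a⁆ = (2 : ℂ) • ⁅x, a⁆ := smul_lie _ _ _
    rw [this, smul_smul]
    norm_num
  rw [e]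
  exact (tangentSpace H).smul_mem _
    ((tangentSpace H).sub_mem h1 ((tangentSpace H).smul_mem _ h2))

theorem sub_apply_mem_tangentSpace
    (hN : ∀ h : selfAdjoint A, ∀ s, ∀ φ ∈ H, flow h s * φ * (flow h s)⁻¹ ∈ H)
    {φ : A ≃⋆ₐ[ℂ] A} (hφ : φ ∈ H) (x : A) : φ x - x ∈ tangentSpace H := by
  have key : ∀ h : selfAdjoint A, φ (h : A) - h ∈ tangentSpace H := by
    intro h
    have h1 := (isTangent_sub_apply hφ h (hN h)).mem_tangentSpace (by
      simp only [map_smul, star_sub, star_smul, ← map_star, h.2.star_eq, Complex.star_def,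
        Complex.conj_I, neg_smul, neg_sub, sub_neg_eq_add]
      abel)
    have e : φ (h : A) - h = Complex.I • (Complex.I • (h : A) - φ (Complex.I • (h : A))) := by
      rw [map_smul, ← smul_sub, smul_smul, Complex.I_mul_I, neg_one_smul, neg_sub]
    rw [e]
    exact (tangentSpace H).smul_mem _ h1
  rw [← realPart_add_I_smul_imaginaryPart x, map_add, map_smul, add_sub_add_comm, ← smul_sub]
  exact (tangentSpace H).add_mem (key _) ((tangentSpace H).smul_mem _ (key _))

/-- If `[J, A]` consists of tangent directions, then all skew-adjoint elements of `J` are tangent,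
since inner derivations by elements of `J` are limits of those by elements of `[J, A]`. -/
theorem ClosedIdeal.isTangent_of_lie_mem (J : ClosedIdeal A)
    (hJ : ∀ x ∈ J.toIdeal, ∀ a, ⁅x, a⁆ ∈ tangentSpace H) {x : A} (hx : x ∈ J.toIdeal)
    (hs : star x = -x) : IsTangent H x := by
  classical
  refine IsTangent.of_approx fun F ε hε => ?_
  obtain ⟨y, hy, hyb⟩ := exists_approx_derivation J (tangentSpace H) hJ hx
    (F ∪ F.image star) hε
  refine ⟨(1 / 2 : ℝ) • (y - star y), hy.1.smul _, fun b hb => ?_⟩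
  have h1 := hyb b (Finset.mem_union_left _ hb)
  have h2 := hyb (star b) (Finset.mem_union_right _ (Finset.mem_image_of_mem _ hb))
  have e : ⁅(1 / 2 : ℝ) • (y - star y), b⁆ - ⁅x, b⁆
      = (1 / 2 : ℝ) • ((⁅y, b⁆ - ⁅x, b⁆) + star (⁅y, star b⁆ - ⁅x, star b⁆)) := by
    have h3 : ⁅(1 / 2 : ℝ) • (y - star y), b⁆ = (1 / 2 : ℝ) • ⁅y - star y, b⁆ := smul_lie _ _ _
    have h4 : ∀ w : A, star ⁅w, star b⁆ = -⁅star w, b⁆ := fun w => by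
      rw [Ring.lie_def, Ring.lie_def, star_sub, star_mul, star_mul, star_star, neg_sub]
    rw [h3, star_sub, h4, h4, hs, neg_lie, sub_lie]
    module
  rw [e, norm_smul, Real.norm_of_nonneg (by norm_num)]
  have h5 := norm_add_le (⁅y, b⁆ - ⁅x, b⁆) (star (⁅y, star b⁆ - ⁅x, star b⁆))
  rw [norm_star] at h5
  linarith

/-- If all skew-adjoint elements of `J` are tangent to the closed group `H`, then `V_J ≤ H`: the
connected group `U_J` is generated by the exponentials of these elements. -/
theorem ClosedIdeal.VAut_le_of_isTangent (J : ClosedIdeal A)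
    (hcl : IsClosed (H : Set (A ≃⋆ₐ[ℂ] A)))
    (hJ : ∀ x ∈ J.toIdeal, star x = -x → IsTangent H x) : J.VAut ≤ H := by
  refine Subgroup.topologicalClosure_minimal _ ?_ hcl
  let G : Subgroup J.unitaryGroup := (H.comap Ad).subgroupOf J.unitaryGroup
  -- the logarithms of unitaries near `1` in `U(J)` are tangent, so `G` is open
  have hG : IsOpen (G : Set J.unitaryGroup) := by
    refine G.isOpen_of_mem_nhds (g := 1) ?_
    have hc : Continuous fun u : J.unitaryGroup => ‖((u : unitary A) : A) - 1‖ :=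
      ((continuous_subtype_val.comp continuous_subtype_val).sub continuous_const).norm
    have hn : {u : J.unitaryGroup | ‖((u : unitary A) : A) - 1‖ < 2} ∈ 𝓝 1 :=
      (isOpen_lt hc continuous_const).mem_nhds (by simp)
    filter_upwards [hn] with u hu
    change Ad (u : unitary A) ∈ H
    rw [← expUnitary_argSelfAdjoint hu]
    refine Ad_expUnitary_mem_of_isTangent hcl _ (hJ _ ?_ ?_)
    · exact J.smul_mem _ (J.argSelfAdjoint_mem u.2 hu)
    · rw [star_smul, (Unitary.argSelfAdjoint (u : unitary A)).2.star_eq, Complex.star_def,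
        Complex.conj_I, neg_smul]
  have hsub : connectedComponent (1 : J.unitaryGroup) ⊆ G :=
    IsClopen.connectedComponent_subset ⟨G.isClosed_of_isOpen hG, hG⟩ G.one_mem
  rintro _ ⟨_, ⟨u, hu, rfl⟩, rfl⟩
  exact hsub hu

end TangentSpace

/-! ### The perfect ideal of a normal subgroup -/

section NormalSubgroups

open selfAdjoint

variable {A : Type*} [CStarAlgebra A]

theorem flow_mem_V (h : selfAdjoint A) (s : ℝ) : flow h s ∈ V A := by
  refine subset_closure ⟨expUnitary (s • h), ?_, rfl⟩
  exact pathComponent_subset_component _ (selfAdjoint.joined_one_expUnitary (s • h))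

theorem ClosedIdeal.mem_ker_P (I : ClosedIdeal A) {φ : CStarNormal.V A} :
    φ ∈ I.P.ker ↔ ∀ x, φ.1 x - x ∈ I.toIdeal := by
  rw [MonoidHom.mem_ker]
  constructor
  · intro h x
    rw [← I.proj_eq_proj, ← I.inducedAut_proj]
    exact congrArg (fun ψ : CStarNormal.V I.Quotient => ψ.1 (I.proj x)) h
  · intro h
    refine Subtype.ext (StarAlgEquiv.ext fun x => ?_)
    obtain ⟨x, rfl⟩ := I.proj_surjective x
    exact (I.proj_eq_proj).2 (h x)

/-- Every closed subgroup of `V_A` normalized by all one-parameter groups lies between `V_J` and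
`ker P_J`, where `J` is the closed ideal generated by all `φ(x) - x`, and `J` is perfect. -/
theorem exists_perfect_ideal {H : Subgroup (A ≃⋆ₐ[ℂ] A)}
    (hcl : IsClosed (H : Set (A ≃⋆ₐ[ℂ] A))) (hV : H ≤ V A)
    (hN : ∀ h : selfAdjoint A, ∀ s, ∀ φ ∈ H, flow h s * φ * (flow h s)⁻¹ ∈ H) :
    ∃ J : ClosedIdeal A, J.IsPerfect ∧ J.VAut ≤ H ∧ ∀ φ ∈ H, ∀ x, φ x - x ∈ J.toIdeal := by
  set J := idealGeneratedBy {z : A | ∃ φ ∈ H, ∃ x, z = φ x - x} with hJ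
  have hsub : ∀ φ ∈ H, ∀ x, φ x - x ∈ J.toIdeal := fun φ hφ x =>
    subset_idealGeneratedBy _ ⟨φ, hφ, x, rfl⟩
  -- a closed ideal modulo which `H` acts by central displacements contains `J`
  have hle : ∀ K : ClosedIdeal A, (∀ φ ∈ H, ∀ x a, ⁅φ x - x, a⁆ ∈ K.toIdeal) →
      J.toIdeal ≤ K.toIdeal := by
    intro K hK
    refine idealGeneratedBy_le ?_
    rintro _ ⟨φ, hφ, x, rfl⟩
    exact K.sub_mem_of_lie_mem (hV hφ) (hK φ hφ) x
  refine ⟨J, ?_, ?_, hsub⟩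
  · set K := idealGeneratedBy (commutatorSpan (J.toIdeal : Set A) (J.toIdeal : Set A) : Set A)
      with hK
    refine ClosedIdeal.ext (le_antisymm (hle K fun φ hφ x a => ?_) ?_)
    · refine lie_mem_of_commutator_mem K (L := J.toIdeal.restrictScalars ℂ)
        (fun y hy b => J.lie_mem hy b) (fun y hy => J.star_mem hy) (fun y hy z hz => ?_)
        (hsub φ hφ x) a
      exact subset_idealGeneratedBy _ (lie_mem_commutatorSpan hy hz)
    · exact idealGeneratedBy_le (commutatorSpan_subset J fun x hx y _ => J.lie_mem hx y)
  · set L := tangentSpace H with hL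
    set K := idealGeneratedBy (commutatorSpan (L : Set A) (L : Set A) : Set A) with hK
    have hJK : J.toIdeal ≤ K.toIdeal := by
      refine hle K fun φ hφ x a => ?_
      exact lie_mem_of_commutator_mem K (fun y hy b => lie_mem_tangentSpace hN hy b)
        (fun y hy => star_mem_tangentSpace hy)
        (fun y hy z hz => subset_idealGeneratedBy _ (lie_mem_commutatorSpan hy hz))
        (sub_apply_mem_tangentSpace hN hφ x) a
    refine J.VAut_le_of_isTangent hcl fun x hx hs => ?_
    refine J.isTangent_of_lie_mem (fun y hy a => ?_) hx hs
    exact lie_mem_of_mem_idealGeneratedBy (isClosed_tangentSpace H)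
      (fun y hy b => lie_mem_tangentSpace hN hy b) (hJK hy) a

theorem ClosedIdeal.exists_mem_closedSubgroupsBetween {H : Subgroup (CStarNormal.V A)}
    (hcl : IsClosed (H : Set (CStarNormal.V A))) (hH : H.Normal) :
    ∃ J : ClosedIdeal A, J.IsPerfect ∧ H ∈ J.closedSubgroupsBetween := by
  have hVcl : IsClosed (CStarNormal.V A : Set (A ≃⋆ₐ[ℂ] A)) :=
    Subgroup.isClosed_topologicalClosure _
  obtain ⟨J, hJ, h1, h2⟩ := exists_perfect_ideal (H := H.map (CStarNormal.V A).subtype)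
    (hVcl.isClosedEmbedding_subtypeVal.isClosedMap _ hcl) (Subgroup.map_subtype_le H) (by
      rintro h s _ ⟨φ, hφ, rfl⟩
      exact ⟨_, hH.conj_mem φ hφ ⟨flow h s, flow_mem_V h s⟩, rfl⟩)
  refine ⟨J, hJ, hcl, fun φ hφ => ?_, fun φ hφ => ?_⟩
  · obtain ⟨ψ, hψ, e⟩ := h1 (Subgroup.mem_subgroupOf.1 hφ)
    rwa [← Subtype.ext e]
  · exact J.mem_ker_P.2 (h2 φ.1 ⟨φ, hφ, rfl⟩)

/-! ### Subgroups between `V_I` and `ker P_I` -/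

theorem continuous_mul_conj {G : Type*} [Group G] [TopologicalSpace G] [IsTopologicalGroup G]
    (g : G) : Continuous fun x : G => x * g * x⁻¹ * g⁻¹ := by
  fun_prop

/-- For `φ ∈ ker P_I` and `ψ ∈ V_A` the group commutator of `ψ` and `φ` lies in `V_I`: for
`ψ = Ad(u)` with `u ∈ U_A` it is `Ad(u φ(u)⁻¹)`, and `u φ(u)⁻¹` depends continuously on `u`. -/
theorem ClosedIdeal.commutator_mem_VAut (I : ClosedIdeal A) {φ ψ : A ≃⋆ₐ[ℂ] A}
    (hφ : ∀ x, φ x - x ∈ I.toIdeal) (hψ : ψ ∈ CStarNormal.V A) :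
    ψ * φ * ψ⁻¹ * φ⁻¹ ∈ I.VAut := by
  have hcl : IsClosed {ψ : A ≃⋆ₐ[ℂ] A | ψ * φ * ψ⁻¹ * φ⁻¹ ∈ I.VAut} := by
    have h : IsClosed (I.VAut : Set (A ≃⋆ₐ[ℂ] A)) := Subgroup.isClosed_topologicalClosure _
    have hc : Continuous fun ψ : A ≃⋆ₐ[ℂ] A => ψ * φ * ψ⁻¹ * φ⁻¹ := continuous_mul_conj φ
    exact h.preimage hc
  refine closure_minimal ?_ hcl hψ
  rintro _ ⟨u, hu, rfl⟩
  let m : A →⋆* A :=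
    { toFun := φ, map_one' := map_one φ, map_mul' := map_mul φ, map_star' := map_star φ }
  let φu := Unitary.map m
  let f : unitary A → I.unitaryGroup := fun v => ⟨v * (φu v)⁻¹, by
    have e : ((v * (φu v)⁻¹ : unitary A) : A) - 1 = -(φ v - v) * star (φ v) := by
      have h1 : φ v * star (φ v) = 1 := by
        rw [← map_star, ← map_mul, Unitary.mul_star_self_of_mem v.2, map_one]
      rw [neg_sub, sub_mul, h1]
      rfl
    change ((v * (φu v)⁻¹ : unitary A) : A) - 1 ∈ I.toIdeal
    rw [e]
    exact I.toIdeal.mul_mem_right _ (I.toIdeal.neg_mem (hφ _))⟩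
  have hφc : Continuous φu :=
    ((StarAlgEquiv.isometry φ).continuous.comp continuous_subtype_val).subtype_mk _
  have hf : Continuous f := (continuous_id.mul hφc.inv).subtype_mk _
  have hf1 : f 1 = 1 := Subtype.ext (by simp [f])
  have hmem := hf.image_connectedComponent_subset (1 : unitary A) ⟨u, hu, rfl⟩
  rw [hf1] at hmem
  refine subset_closure ⟨(f u : unitary A), ⟨f u, hmem, rfl⟩, ?_⟩
  have hconj : Ad (φu u) = φ * Ad u * φ⁻¹ := by
    refine StarAlgEquiv.ext fun x => ?_
    rw [aut_mul_apply, aut_mul_apply, Ad_apply, Ad_apply, map_mul, map_mul, map_star,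
      aut_apply_inv_self]
    rfl
  change Ad (u * (φu u)⁻¹) = _
  rw [map_mul, map_inv, hconj]
  group

theorem ClosedIdeal.normal_of_mem_closedSubgroupsBetween (I : ClosedIdeal A)
    {H : Subgroup (CStarNormal.V A)} (hH : H ∈ I.closedSubgroupsBetween) : H.Normal := by
  refine ⟨fun φ hφ ψ => ?_⟩
  have h := I.commutator_mem_VAut (I.mem_ker_P.1 (hH.2.2 hφ)) ψ.2
  have h' : ψ * φ * ψ⁻¹ * φ⁻¹ ∈ H := hH.2.1 (Subgroup.mem_subgroupOf.2 h)
  simpa using H.mul_mem h' hφ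

/-! ### Uniqueness of the perfect ideal -/

/-- The unitaries `exp(i t h)` form a path in `U(I)` starting at `1`. -/
theorem ClosedIdeal.flow_mem_VAut (I : ClosedIdeal A) (h : selfAdjoint A)
    (hh : (h : A) ∈ I.toIdeal) (t : ℝ) : flow h t ∈ I.VAut := by
  let _ : NormedAlgebra ℚ A := .restrictScalars ℚ ℂ A
  let f : ℝ → I.unitaryGroup := fun s => ⟨expUnitary (s • h), by
    change ((expUnitary (s • h) : unitary A) : A) - 1 ∈ I.toIdeal
    have hs : I.proj (Complex.I • ((s • h : selfAdjoint A) : A)) = 0 := by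
      rw [I.proj_smul, selfAdjoint.val_smul, ← Complex.coe_smul, I.proj_smul, I.proj_eq_zero.2 hh,
        smul_zero, smul_zero]
    rw [← I.proj_eq_proj, expUnitary_coe]
    refine (NormedSpace.map_exp I.projStarAlgHom I.continuous_projStarAlgHom _).trans ?_
    change NormedSpace.exp (I.proj _) = _
    rw [hs, NormedSpace.exp_zero, map_one]⟩
  have hf : Continuous f :=
    (continuous_expUnitary.comp (continuous_id.smul continuous_const)).subtype_mk _
  have hf0 : f 0 = 1 := Subtype.ext (by simp [f])
  have hmem := (isPreconnected_range hf).subset_connectedComponent ⟨0, hf0⟩ ⟨t, rfl⟩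
  exact subset_closure ⟨_, ⟨f t, hmem, rfl⟩, rfl⟩

/-- If `V_I` acts trivially on `A / J`, then so do the derivations by elements of `I`; thus
`[I, I] ⊆ J`, which for perfect `I` means `I ⊆ J`. -/
theorem ClosedIdeal.le_of_VAut_le (I J : ClosedIdeal A) (hI : I.IsPerfect)
    (h : I.V ≤ J.P.ker) : I.toIdeal ≤ J.toIdeal := by
  have key : ∀ x : selfAdjoint A, (x : A) ∈ I.toIdeal → ∀ a, ⁅(x : A), a⁆ ∈ J.toIdeal := by
    intro x hx a
    have ht := (hasDerivAt_iff_tendsto_slope_zero.1 (hasDerivAt_flow x a))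
    have hm : ⁅Complex.I • (x : A), a⁆ ∈ J.toIdeal := by
      refine J.isClosed.mem_of_tendsto ht (Eventually.of_forall fun t => ?_)
      rw [zero_add, flow_zero, aut_one_apply, ← Complex.coe_smul]
      refine J.smul_mem _ (J.mem_ker_P.1 (h (x := ⟨flow x t, flow_mem_V x t⟩) ?_) a)
      exact Subgroup.mem_subgroupOf.2 (I.flow_mem_VAut x hx t)
    have e : ⁅(x : A), a⁆ = (-Complex.I) • ⁅Complex.I • (x : A), a⁆ := by
      have : ⁅Complex.I • (x : A), a⁆ = Complex.I • ⁅(x : A), a⁆ := smul_lie _ _ _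
      rw [this, smul_smul, neg_mul, Complex.I_mul_I, neg_neg, one_smul]
    rw [e]
    exact J.smul_mem _ hm
  rw [hI]
  refine idealGeneratedBy_le (commutatorSpan_subset J fun x hx y _ => ?_)
  have hre : ∀ z ∈ I.toIdeal, (realPart z : A) ∈ I.toIdeal := fun z hz => by
    rw [realPart_apply_coe, ← Complex.coe_smul]
    exact I.smul_mem _ (I.toIdeal.add_mem hz (I.star_mem hz))
  have him : (imaginaryPart x : A) ∈ I.toIdeal := by
    rw [imaginaryPart_apply_coe, ← Complex.coe_smul]
    exact I.smul_mem _ (I.smul_mem _ (I.toIdeal.sub_mem hx (I.star_mem hx)))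
  rw [← realPart_add_I_smul_imaginaryPart x, add_lie]
  have e : ⁅Complex.I • (imaginaryPart x : A), y⁆ = Complex.I • ⁅(imaginaryPart x : A), y⁆ :=
    smul_lie _ _ _
  rw [e]
  exact J.toIdeal.add_mem (key _ (hre x hx) y) (J.smul_mem _ (key _ him y))

end NormalSubgroups

end CStarNormal

end

theorem mainTheorem2 (A : Type*) [CStarAlgebra A] :
    {H : Subgroup (CStarNormal.V A) | IsClosed (H : Set (CStarNormal.V A)) ∧ H.Normal} =
        ⋃ I ∈ {I : CStarNormal.ClosedIdeal A | I.IsPerfect}, I.closedSubgroupsBetween ∧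
      {I : CStarNormal.ClosedIdeal A | I.IsPerfect}.PairwiseDisjoint
        (fun I => I.closedSubgroupsBetween) := by
  constructor
  · ext H
    simp only [Set.mem_iUnion, exists_prop]
    constructor
    · rintro ⟨hcl, hH⟩
      exact CStarNormal.ClosedIdeal.exists_mem_closedSubgroupsBetween hcl hH
    · rintro ⟨I, -, hH⟩
      exact ⟨hH.1, I.normal_of_mem_closedSubgroupsBetween hH⟩
  · intro I hI J hJ hne
    refine Set.disjoint_left.2 fun H hHI hHJ => hne (CStarNormal.ClosedIdeal.ext (le_antisymm ?_ ?_))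
    · exact I.le_of_VAut_le J hI (hHI.2.1.trans hHJ.2.2)
    · exact J.le_of_VAut_le I hJ (hHJ.2.1.trans hHI.2.2)
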